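/- Let $\nu=(\nu_0,\dots,\nu_n)$ be a sequence of non-negative integers, encoding the north-east lattice path $E^{\nu_0}NE^{\nu_1}\cdots NE^{\nu_n}$, and let $\delta=(\delta_1,\dots,\delta_n)$ be an increment vector, i.e. integers with $0\le\delta_i\le\nu_i$. **The lattice.** Put $\check\nu_0=\sum_{i=0}^n\nu_i-\sum_{i=1}^n\delta_i$ and let $\check\nu=E^{\check\nu_0}NE^{\delta_1}\cdots NE^{\delta_n}$, starting at $(0,0)$; let $\hat\nu$ be the north-west path $W^{\nu_0}NW^{\nu_1-\delta_1}\cdots NW^{\nu_n-\delta_n}$ starting at $(\check\nu_0,0)$. Let $F_{\check\nu}$ be the region weakly above $\check\nu$ in its bounding rectangle, and let the shape $F_{\delta,\nu}$ be the part of $F_{\check\nu}$ weakly above $\hat\nu$. Two lattice points of $F_{\delta,\nu}$ are incompatible if one is strictly south-west of the other and the smallest rectangle containing both lies in $F_{\check\nu}$. A $(\delta,\nu)$-tree is a maximal set of pairwise compatible lattice points of $F_{\delta,\nu}$. If $p,r$ are nodes of a tree $T$ with $p$ strictly north-west of $r$, if the south-west corner $q$ of the smallest rectangle containing $p$ and $r$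 is a node of $T$, and if this rectangle contains no further node of $T$, then replacing $q$ by the north-east corner $q'$ of the rectangle is a right rotation $T\to T'$ and $q'$ is called a descent of $T'$. The alt $\nu$-Tamari lattice $Tam_\nu(\delta)$ is the set of $(\delta,\nu)$-trees ordered by the reflexive transitive closure of right rotations. **The complex.** The faces of the canonical join complex $\Delta$ of $Tam_\nu(\delta)$ are the canonical join representations of its elements: the canonical join representation of $a$ is the irredundant set $A$ of join-irreducible elements (elements covering exactly one element) with $\bigvee A=a$ such that for every set $B$ of join-irreducible elements with $\bigvee B=a$, each $x\in A$ lies below some $y\in B$. A complex is (non-pure) shellable if its facets can be ordered $F_0,F_1,\dots,F_m$ (a shelling) such that for each $j>0$ the intersection of the complex generated by $F_j$ with the complex generated by $F_0,\dots,F_{j-1}$ is pure of dimension $\dim F_j-1$. **Boxes and labels.** The boxes are the unit squares of $F_{\delta,\nu}$. A join-irreducible tree has exactly one descent, and we identify it with the box whose north-east corner is this descent. Two distinct boxes are incompatible if they lie in the same row or column, or if one is south-west of the other and the smallest rectangle of boxes containing both lies in $F_{\delta,\nu}$. Going through the rows from bottom to top, choose in each row the rightmost box compatible with all boxes chosen so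 far, if there is one; this gives boxes $q_1,q_2,\dots,q_k$. The label of a box is the least $i$ such that the box lies in the row or column of $q_i$. **Statement.** The canonical join complex $\Delta$ of $Tam_\nu(\delta)$ is a simplicial complex and is (non-pure) shellable. Moreover, for every linear order of the boxes in which boxes with larger labels precede boxes with smaller labels, $\Delta$ has a shelling $F_0,F_1,\dots,F_m$ that begins with $F_0=\{q_1,\dots,q_k\}$ and in which $F_1,\dots,F_m$ are ordered by the last box outside $\{q_1,\dots,q_k\}$ that they contain: if $0<i<j$, then the last such box of $F_i$ is equal to or precedes the last such box of $F_j$. -/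

import Mathlib

/-! ### Canonical join representations and the canonical join complex of a poset -/

namespace CanonicalJoin

variable {α : Type*} [PartialOrder α]

/-- `j` covers exactly one element. -/
def IsJoinIrr (j : α) : Prop := ∃! x, x ⋖ j

/-- `A` is a join representation of `a`: a set of join-irreducible elements with join `a`. -/
def IsJoinRep (A : Finset α) (a : α) : Prop :=
  (∀ j ∈ A, IsJoinIrr j) ∧ IsLUB (A : Set α) a

/-- Refinement: every element of `A` lies below some element of `B`. -/
def Refines (A B : Finset α) : Prop := ∀ x ∈ A, ∃ y ∈ B, x ≤ y

/-- `A` is the canonical join representation of `a`: an irredundant join representation that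
refines every join representation of `a`. (Refinement is antisymmetric on irredundant sets, so
for given `a` there is at most one such `A`.) -/
def IsCanonicalJoinRep (A : Finset α) (a : α) : Prop :=
  IsJoinRep A a ∧ (∀ B, B ⊂ A → ¬ IsLUB (B : Set α) a) ∧ ∀ B, IsJoinRep B a → Refines A B

/-- The canonical join complex: its faces are the canonical join representations. -/
def complex (α : Type*) [PartialOrder α] : Set (Finset α) :=
  {A | ∃ a, IsCanonicalJoinRep A a}

end CanonicalJoin

/-! ### Simplicial complexes (with the empty face) and non-pure shellability -/

namespace Shelling

/-- A nonempty family of finite sets that is closed under taking subsets. -/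
def IsSimplicialComplex {V : Type*} (K : Set (Finset V)) : Prop := K.Nonempty ∧ IsLowerSet K

/-- A facet is an inclusion-maximal face. -/
def IsFacet {V : Type*} (K : Set (Finset V)) (F : Finset V) : Prop := Maximal (· ∈ K) F

/-- `K` is pure of dimension `d - 1`: all its facets have `d` elements. -/
def IsPure {V : Type*} (K : Set (Finset V)) (d : ℕ) : Prop := ∀ F, IsFacet K F → F.card = d

/-- `F 0, …, F m` is a (non-pure) shelling of `K`: it enumerates the facets of `K` without
repetition, and for `j > 0` the intersection of the complex generated by `F j` with the complex
generated by `F 0, …, F (j - 1)` is pure of dimension `dim (F j) - 1`. -/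
def IsShelling {V : Type*} (K : Set (Finset V)) {m : ℕ} (F : Fin (m + 1) → Finset V) : Prop :=
  Function.Injective F ∧ (∀ G, IsFacet K G ↔ ∃ i, F i = G) ∧
    ∀ j, 0 < j →
      ∃ d, d + 1 = (F j).card ∧ IsPure {G | G ⊆ F j ∧ ∃ i, i < j ∧ G ⊆ F i} d

/-- The finite complex `K` is (non-pure) shellable. -/
def IsShellable {V : Type*} (K : Set (Finset V)) : Prop :=
  ∃ (m : ℕ) (F : Fin (m + 1) → Finset V), IsShelling K F

end Shelling

/-! ### The alt `ν`-Tamari lattice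

A north-east path with `n` north steps is encoded by `ν : Fin (n + 1) → ℕ`; an increment vector
`(δ₁, …, δₙ)` is `δ : Fin n → ℕ`, with `δ i` in the role of `δ_{i+1}`, subject to
`δ i ≤ ν i.succ`. Points of the plane are pairs `(x, y)`, `x` growing to the east and `y` to the
north. -/

namespace AltTamari

variable {n : ℕ} (ν : Fin (n + 1) → ℕ) (δ : Fin n → ℕ)

/-- The initial number of east steps `ν̌₀` of `ν̌ = (ν̌₀, δ₁, …, δₙ)`. -/
def check₀ : ℕ := ∑ i, ν i - ∑ i, δ i

/-- The easternmost abscissa of the path `ν̌` at height `y`. -/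
def right (y : ℕ) : ℕ := check₀ ν δ + ∑ i with i.val < y, δ i

/-- The westernmost abscissa at height `y` of the path `ν̂`, which starts at `(ν̌₀, 0)` with steps
`W^{ν₀} N W^{ν₁ - δ₁} ⋯ N W^{νₙ - δₙ}`. -/
def left (y : ℕ) : ℕ := check₀ ν δ - (ν 0 + ∑ i with i.val < y, (ν i.succ - δ i))

/-- The lattice points of the Ferrers diagram of `ν̌`: those weakly above `ν̌` in its bounding
rectangle. -/
def ferrersPoints : Finset (ℕ × ℕ) :=
  {p ∈ Finset.range (∑ i, ν i + 1) ×ˢ Finset.range (n + 1) | p.1 ≤ right ν δ p.2}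

/-- The lattice points of the shape `F_{δ,ν}`: those that lie moreover weakly above `ν̂`. -/
def points : Finset (ℕ × ℕ) := {p ∈ ferrersPoints ν δ | left ν δ p.2 ≤ p.1}

/-- `p` is strictly south-west of `q`. -/
def SW (p q : ℕ × ℕ) : Prop := p.1 < q.1 ∧ p.2 < q.2

instance (p q : ℕ × ℕ) : Decidable (SW p q) := inferInstanceAs (Decidable (_ ∧ _))

/-- `p` and `q` are `ν̌`-incompatible: one is strictly south-west of the other and the smallest
rectangle containing them lies in the Ferrers diagram of `ν̌`. -/
def Incompatible (p q : ℕ × ℕ) : Prop :=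
  (SW p q ∧ Finset.Icc p q ⊆ ferrersPoints ν δ) ∨ (SW q p ∧ Finset.Icc q p ⊆ ferrersPoints ν δ)

/-- A `(δ,ν)`-tree is a maximal set of pairwise `ν̌`-compatible points of the shape. -/
def IsTree (T : Finset (ℕ × ℕ)) : Prop :=
  Maximal (fun S : Finset (ℕ × ℕ) =>
    S ⊆ points ν δ ∧ ∀ p ∈ S, ∀ q ∈ S, ¬ Incompatible ν δ p q) T

/-- `T'` arises from `T` by the right rotation that exchanges `q` with `q'`: there are nodes `p`
and `r` with `p` strictly north-west of `r` such that `q`, `q'` are the south-west and north-east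
corners of the smallest rectangle containing `p` and `r`, and `p, q, r` are the only nodes of `T`
in this rectangle. -/
def IsRightRotation (T T' : Finset (ℕ × ℕ)) (q q' : ℕ × ℕ) : Prop :=
  ∃ p ∈ T, ∃ r ∈ T, p.1 < r.1 ∧ r.2 < p.2 ∧ q = (p.1, r.2) ∧ q' = (r.1, p.2) ∧ q ∈ T ∧
    (∀ s ∈ T, s ∈ Finset.Icc q q' → s = p ∨ s = q ∨ s = r) ∧ T' = insert q' (T.erase q)

/-- The type of `(δ,ν)`-trees. -/
def Tree : Type := {T : Finset (ℕ × ℕ) // IsTree ν δ T}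

variable {ν δ}

/-- Two `(δ,ν)`-trees related by a right rotation. -/
def Tree.RotatesTo (T T' : Tree ν δ) : Prop := ∃ q q', IsRightRotation T.1 T'.1 q q'

theorem Tree.RotatesTo.sum_lt {T T' : Tree ν δ} (h : T.RotatesTo T') :
    ∑ s ∈ T.1, s.2 < ∑ s ∈ T'.1, s.2 := by
  obtain ⟨q, q', p, hp, r, hr, h1, h2, hq, hq', hqT, hs, hT'⟩ := h
  have hne : q' ∉ T.1 := by
    intro hmem
    have hIcc : q' ∈ Finset.Icc q q' := by
      subst hq hq'
      simp only [Finset.mem_Icc, Prod.mk_le_mk, le_refl, and_true]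
      omega
    rcases hs q' hmem hIcc with h | h | h
    · rw [← h, hq'] at h1; simp at h1
    · rw [hq, hq'] at h; simp only [Prod.mk.injEq] at h; omega
    · rw [← h, hq'] at h2; simp at h2
  have hne' : q' ∉ T.1.erase q := fun h => hne (Finset.mem_of_mem_erase h)
  rw [hT', Finset.sum_insert hne', ← Finset.add_sum_erase _ _ hqT]
  have : q.2 < q'.2 := by rw [hq, hq']; exact h2
  omega

/-- The alt `ν`-Tamari lattice: `(δ,ν)`-trees, ordered by the reflexive and transitive closure of
right rotations. -/
instance : PartialOrder (Tree ν δ) where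
  le := Relation.ReflTransGen Tree.RotatesTo
  le_refl _ := Relation.ReflTransGen.refl
  le_trans _ _ _ := Relation.ReflTransGen.trans
  le_antisymm := by
    have key : ∀ {T T' : Tree ν δ}, Relation.ReflTransGen Tree.RotatesTo T T' →
        T = T' ∨ ∑ s ∈ T.1, s.2 < ∑ s ∈ T'.1, s.2 := by
      intro T T' h
      induction h with
      | refl => exact Or.inl rfl
      | tail _ hr ih =>
        rcases ih with rfl | ih
        · exact Or.inr hr.sum_lt
        · exact Or.inr (ih.trans hr.sum_lt)
    intro T T' h h'
    rcases key h with rfl | h1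
    · rfl
    · rcases key h' with rfl | h2
      · rfl
      · omega

/-- `q'` is a descent of `T'`: a left rotation can be applied at this node. -/
def Tree.IsDescent (T' : Tree ν δ) (q' : ℕ × ℕ) : Prop :=
  ∃ (T : Tree ν δ) (q : ℕ × ℕ), IsRightRotation T.1 T'.1 q q'

/-- The boxes of the vertices of a face. A box is named by its south-west corner; the box of a
join-irreducible tree is the one whose north-east corner is the unique descent of the tree. -/
def faceBoxes (F : Finset (Tree ν δ)) : Set (ℕ × ℕ) :=
  {b | ∃ T ∈ F, T.IsDescent (b.1 + 1, b.2 + 1)}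

variable (ν δ)

/-- The unit boxes of the shape `F_{δ,ν}`, each named by its south-west corner. -/
def boxes : Finset (ℕ × ℕ) :=
  {b ∈ points ν δ | Finset.Icc b (b.1 + 1, b.2 + 1) ⊆ points ν δ}

/-- Incompatible boxes: distinct, and either in the same column or row, or one south-west of the
other with the smallest rectangle containing both inside the shape. -/
def BoxIncompatible (a b : ℕ × ℕ) : Prop :=
  a ≠ b ∧ (a.1 = b.1 ∨ a.2 = b.2 ∨
    (SW a b ∧ Finset.Icc a b ⊆ boxes ν δ) ∨ (SW b a ∧ Finset.Icc b a ⊆ boxes ν δ))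

instance (a b : ℕ × ℕ) : Decidable (BoxIncompatible ν δ a b) :=
  inferInstanceAs (Decidable (_ ∧ _))

/-- The greedy boxes in the lowest `y` rows, from bottom to top: in each row the rightmost box
that is compatible with the boxes chosen below, if there is one. -/
def greedyBelow : ℕ → List (ℕ × ℕ)
  | 0 => []
  | y + 1 =>
    let c := {b ∈ boxes ν δ | b.2 = y ∧ ∀ a ∈ greedyBelow y, ¬ BoxIncompatible ν δ a b}
    if c = ∅ then greedyBelow y else greedyBelow y ++ [(c.sup Prod.fst, y)]

/-- The list `q₁, q₂, …` of greedy boxes of the whole shape. -/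
def greedy : List (ℕ × ℕ) := greedyBelow ν δ n

/-- The label of a box: the least `i ≥ 1` such that the box is in the row or column of `qᵢ`. -/
def label (b : ℕ × ℕ) : ℕ :=
  (greedy ν δ).findIdx (fun q => decide (q.1 = b.1 ∨ q.2 = b.2)) + 1

/-- The canonical join complex of the alt `ν`-Tamari lattice. -/
def canonicalJoinComplex : Set (Finset (Tree ν δ)) := CanonicalJoin.complex (Tree ν δ)

end AltTamari

open AltTamari

/-! ### The shape -/

namespace AltTamari

section Shape

variable {n : ℕ} {ν : Fin (n + 1) → ℕ} {δ : Fin n → ℕ}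

/-! A tree is determined by the heights of the top nodes in its columns. The functions that arise
are those of `IsHeight`, and the rotation order becomes the pointwise order (`Tree.le_iff`): if `h ≤
g` fails, `h` can be lowered to `g` in the rightmost column where it is larger, and the smallest
possible lowering of one column undoes a right rotation.

For a box `b`, `boxTree` gives the least tree whose height in column `b.1 + 1` exceeds `b.2`; it is
join-irreducible. Each column of a tree that can be lowered has a canonical box, at the highest
level to which it can be lowered, and the trees of these boxes form the canonical join
representation. The sets of canonical boxes are exactly the sets of pairwise compatible boxes
(`canonicalBox_iff_mem`), so the complex is the independence complex of the incompatibility graph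
(`mem_canonicalJoinComplex_iff`).

If the closed neighbourhood of a vertex `q` is a clique, each facet contains exactly one of its
vertices, and a set away from a neighbour `v` is also away from `q`. Hence shellings of the parts
away from `q` and from each `v` concatenate, after adding `q` or `v`, with the block of `q` first
and the others in any order (`isShellingList_of_isSimplicial`). Among the boxes in given rows and
columns, the rightmost one of the lowest nonempty row is such a `q`, and what is away from it or
from a neighbour splits into at most two mutually compatible sets of the same kind with fewer rows
(`exists_away_eq`).

Following the block of `q` in every step produces the greedy boxes. The neighbours of the current
greedy box have smaller labels than all boxes away from it, so `v` is the last non-greedy box of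
each facet in its block, and sorting the blocks gives the required order. -/

theorem right_mono : Monotone (right ν δ) := by
  intro a b hab
  unfold right
  gcongr

theorem left_anti : Antitone (left ν δ) := by
  intro a b hab
  unfold left
  gcongr

theorem left_le_right (y : ℕ) : left ν δ y ≤ right ν δ y :=
  (Nat.sub_le _ _).trans (Nat.le_add_right _ _)

theorem sum_delta_le (hδ : ∀ i, δ i ≤ ν i.succ) : ∑ i, δ i ≤ ∑ i, ν i := by
  rw [Fin.sum_univ_succ]
  exact (Finset.sum_le_sum fun i _ => hδ i).trans (Nat.le_add_left _ _)

/-- The path `ν̂` has `∑ ν - ∑ δ = ν̌₀` west steps in total, so it ends on the line `x = 0`. -/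
theorem left_top (hδ : ∀ i, δ i ≤ ν i.succ) : left ν δ n = 0 := by
  unfold left check₀
  have h1 : ∑ i : Fin n with i.val < n, (ν i.succ - δ i) = ∑ i : Fin n, ν i.succ - ∑ i, δ i := by
    rw [Finset.filter_true_of_mem (fun i _ => i.2)]
    exact Finset.sum_tsub_distrib _ fun i _ => hδ i
  rw [h1, Fin.sum_univ_succ]
  omega

theorem right_top (hδ : ∀ i, δ i ≤ ν i.succ) : right ν δ n = ∑ i, ν i := by
  unfold right check₀
  rw [Finset.filter_true_of_mem (fun i _ => i.2)]
  have := sum_delta_le hδ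
  omega

theorem mem_ferrersPoints (hδ : ∀ i, δ i ≤ ν i.succ) {p : ℕ × ℕ} :
    p ∈ ferrersPoints ν δ ↔ p.2 ≤ n ∧ p.1 ≤ right ν δ p.2 := by
  simp only [ferrersPoints, Finset.mem_filter, Finset.mem_product, Finset.mem_range]
  constructor
  · rintro ⟨⟨_, h⟩, h'⟩
    exact ⟨by omega, h'⟩
  · rintro ⟨h, h'⟩
    have := right_mono (ν := ν) (δ := δ) h
    rw [right_top hδ] at this
    exact ⟨⟨by omega, by omega⟩, h'⟩

theorem mem_points (hδ : ∀ i, δ i ≤ ν i.succ) {p : ℕ × ℕ} :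
    p ∈ points ν δ ↔ p.2 ≤ n ∧ left ν δ p.2 ≤ p.1 ∧ p.1 ≤ right ν δ p.2 := by
  simp only [points, Finset.mem_filter, mem_ferrersPoints hδ]
  tauto

theorem Icc_subset_ferrersPoints (hδ : ∀ i, δ i ≤ ν i.succ) {p q : ℕ × ℕ} (h : SW p q)
    (hq : q.2 ≤ n) : Finset.Icc p q ⊆ ferrersPoints ν δ ↔ q.1 ≤ right ν δ p.2 := by
  obtain ⟨h1, h2⟩ := h
  constructor
  · intro hs
    have : (q.1, p.2) ∈ ferrersPoints ν δ := hs (by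
      simp only [Finset.mem_Icc, Prod.le_def]; omega)
    exact ((mem_ferrersPoints hδ).1 this).2
  · intro hr s hs
    simp only [Finset.mem_Icc, Prod.le_def] at hs
    have := right_mono (ν := ν) (δ := δ) hs.1.2
    exact (mem_ferrersPoints hδ).2 ⟨by omega, by omega⟩

theorem incompatible_iff (hδ : ∀ i, δ i ≤ ν i.succ) {p q : ℕ × ℕ} (hp : p.2 ≤ n) (hq : q.2 ≤ n) :
    Incompatible ν δ p q ↔
      (SW p q ∧ q.1 ≤ right ν δ p.2) ∨ (SW q p ∧ p.1 ≤ right ν δ q.2) := by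
  unfold Incompatible
  rw [and_congr_right fun h => Icc_subset_ferrersPoints hδ h hq,
    and_congr_right fun h => Icc_subset_ferrersPoints hδ h hp]

theorem mem_boxes (hδ : ∀ i, δ i ≤ ν i.succ) {b : ℕ × ℕ} :
    b ∈ boxes ν δ ↔ b.2 < n ∧ left ν δ b.2 ≤ b.1 ∧ b.1 < right ν δ b.2 := by
  simp only [boxes, Finset.mem_filter, mem_points hδ]
  constructor
  · rintro ⟨⟨h1, h2, h3⟩, hs⟩
    have e1 : (b.1 + 1, b.2) ∈ points ν δ := hs (by
      simp only [Finset.mem_Icc, Prod.le_def]; omega)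
    have e2 : (b.1, b.2 + 1) ∈ points ν δ := hs (by
      simp only [Finset.mem_Icc, Prod.le_def]; omega)
    rw [mem_points hδ] at e1 e2
    dsimp only at e1 e2
    omega
  · rintro ⟨h1, h2, h3⟩
    refine ⟨by omega, fun s hs => ?_⟩
    simp only [Finset.mem_Icc, Prod.le_def] at hs
    have e1 := right_mono (ν := ν) (δ := δ) hs.1.2
    have e2 := left_anti (ν := ν) (δ := δ) hs.1.2
    rw [mem_points hδ]
    omega

theorem Icc_subset_boxes (hδ : ∀ i, δ i ≤ ν i.succ) {a b : ℕ × ℕ} (h : SW a b)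
    (ha : a ∈ boxes ν δ) (hb : b ∈ boxes ν δ) :
    Finset.Icc a b ⊆ boxes ν δ ↔ b.1 < right ν δ a.2 := by
  obtain ⟨h1, h2⟩ := h
  rw [mem_boxes hδ] at ha hb
  constructor
  · intro hs
    have : (b.1, a.2) ∈ boxes ν δ := hs (by
      simp only [Finset.mem_Icc, Prod.le_def]; omega)
    exact ((mem_boxes hδ).1 this).2.2
  · intro hr s hs
    simp only [Finset.mem_Icc, Prod.le_def] at hs
    have e1 := right_mono (ν := ν) (δ := δ) hs.1.2
    have e2 := left_anti (ν := ν) (δ := δ) hs.1.2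
    rw [mem_boxes hδ]
    omega

theorem boxIncompatible_iff (hδ : ∀ i, δ i ≤ ν i.succ) {a b : ℕ × ℕ}
    (ha : a ∈ boxes ν δ) (hb : b ∈ boxes ν δ) :
    BoxIncompatible ν δ a b ↔ a ≠ b ∧ (a.1 = b.1 ∨ a.2 = b.2 ∨
      (a.1 < b.1 ∧ a.2 < b.2 ∧ b.1 < right ν δ a.2) ∨
      (b.1 < a.1 ∧ b.2 < a.2 ∧ a.1 < right ν δ b.2)) := by
  unfold BoxIncompatible
  rw [and_congr_right fun h => Icc_subset_boxes hδ h ha hb,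
    and_congr_right fun h => Icc_subset_boxes hδ h hb ha]
  simp only [SW, and_assoc]

theorem BoxIncompatible.symm {a b : ℕ × ℕ} (h : BoxIncompatible ν δ a b) :
    BoxIncompatible ν δ b a := by
  unfold BoxIncompatible at *
  obtain ⟨h1, h2⟩ := h
  exact ⟨h1.symm, by tauto⟩

end Shape

/-! ### Height functions -/

/-- The functions that record, for every column, the height of the topmost node of a tree on the
shape with rows `[ℓ y, r y]`, `y ≤ n`; columns outside the shape get the value `n`. -/
structure IsHeight (n : ℕ) (ℓ r : ℕ → ℕ) (h : ℕ → ℕ) : Prop where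
  le (x : ℕ) : h x ≤ n
  base (x : ℕ) : h x < n → ℓ (h x) < x ∧ x ≤ r (h x)
  mono {x x' : ℕ} : x < x' → x' ≤ r (h x) → h x' ≤ h x

/-- The height at `X` can be lowered to `y`. -/
def IsDrop (ℓ r : ℕ → ℕ) (h : ℕ → ℕ) (X y : ℕ) : Prop :=
  y < h X ∧ ℓ y < X ∧ X ≤ r y ∧ ∀ x, X < x → x ≤ r y → h x ≤ y

/-- The least height function whose graph is weakly above all points of `S`. -/
noncomputable def hull (n : ℕ) (ℓ r : ℕ → ℕ) (S : Finset (ℕ × ℕ)) (x : ℕ) : ℕ :=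
  sInf {k | ∃ h, IsHeight n ℓ r h ∧ (∀ p ∈ S, p.2 ≤ h p.1) ∧ h x = k}

section Height

variable {n : ℕ} {ℓ r : ℕ → ℕ} {h g : ℕ → ℕ}

theorem isHeight_const : IsHeight n ℓ r fun _ => n :=
  ⟨fun _ => le_rfl, fun _ h => absurd h (lt_irrefl _), fun _ _ => le_rfl⟩

/-- A test function: it dominates every point compatible with a point `(a, b)` of the shape, since
points strictly north-east of `(a, b)` must lie beyond `r b`. The value `n` imposes no constraint.
-/
theorem isHeight_bound {a b : ℕ} (hb : b ≤ n) (ha : ℓ b ≤ a) :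
    IsHeight n ℓ r fun x => if a < x ∧ x ≤ r b then b else n where
  le x := by split_ifs <;> omega
  base x := by
    split_ifs with hx
    · intro _; omega
    · omega
  mono {x x'} h1 := by
    split_ifs <;> intros <;> omega

theorem exists_hull {S : Finset (ℕ × ℕ)} (hS : ∀ p ∈ S, p.2 ≤ n) (x : ℕ) :
    ∃ h, IsHeight n ℓ r h ∧ (∀ p ∈ S, p.2 ≤ h p.1) ∧ h x = hull n ℓ r S x :=
  Nat.sInf_mem (s := {k | ∃ h, IsHeight n ℓ r h ∧ (∀ p ∈ S, p.2 ≤ h p.1) ∧ h x = k})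
    ⟨n, _, isHeight_const, hS, rfl⟩

theorem hull_le {S : Finset (ℕ × ℕ)} (hh : IsHeight n ℓ r h) (hS : ∀ p ∈ S, p.2 ≤ h p.1) :
    hull n ℓ r S ≤ h :=
  fun _ => Nat.sInf_le ⟨h, hh, hS, rfl⟩

theorem le_hull {S : Finset (ℕ × ℕ)} (hS : ∀ p ∈ S, p.2 ≤ n) :
    ∀ p ∈ S, p.2 ≤ hull n ℓ r S p.1 := by
  intro p hp
  obtain ⟨h, -, h2, h3⟩ := exists_hull (ℓ := ℓ) (r := r) hS p.1
  exact (h2 p hp).trans_eq h3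

/-- The conditions survive pointwise minima: a function attaining the minimum at `x` also bounds the
minimum at `x'`. -/
theorem isHeight_hull {S : Finset (ℕ × ℕ)} (hS : ∀ p ∈ S, p.2 ≤ n) :
    IsHeight n ℓ r (hull n ℓ r S) where
  le x := by
    obtain ⟨h, h1, -, h3⟩ := exists_hull (ℓ := ℓ) (r := r) hS x
    exact h3 ▸ h1.le x
  base x := by
    obtain ⟨h, h1, -, h3⟩ := exists_hull (ℓ := ℓ) (r := r) hS x
    exact h3 ▸ h1.base x
  mono {x x'} hx := by
    obtain ⟨h, h1, h2, h3⟩ := exists_hull (ℓ := ℓ) (r := r) hS x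
    rw [← h3]
    exact fun hx' => (hull_le h1 h2 x').trans (h1.mono hx hx')

theorem IsDrop.isHeight_update {X y : ℕ} (hd : IsDrop ℓ r h X y) (hh : IsHeight n ℓ r h) :
    IsHeight n ℓ r (Function.update h X y) := by
  obtain ⟨h1, h2, h3, h4⟩ := hd
  have hX := hh.le X
  refine ⟨fun x => ?_, fun x => ?_, fun {x x'} hx => ?_⟩
  · rcases eq_or_ne x X with rfl | hne
    · simp only [Function.update_self]; omega
    · simpa only [Function.update_of_ne hne] using hh.le x
  · rcases eq_or_ne x X with rfl | hne
    · simp only [Function.update_self]; exact fun _ => ⟨h2, h3⟩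
    · simpa only [Function.update_of_ne hne] using hh.base x
  · rcases eq_or_ne x X with rfl | hne
    · rw [Function.update_self, Function.update_of_ne (by omega)]
      exact h4 x' hx
    · rw [Function.update_of_ne hne]
      intro hx'
      have := hh.mono hx hx'
      rcases eq_or_ne x' X with rfl | hne'
      · rw [Function.update_self]; omega
      · rwa [Function.update_of_ne hne']

/-- Take the rightmost column with `g < h`, which exists because such columns lie in `[0, r n]`.
East of it `h ≤ g`, so monotonicity of `g` bounds `h`. -/
theorem exists_drop_of_not_le (hr : Monotone r) (hh : IsHeight n ℓ r h) (hg : IsHeight n ℓ r g)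
    (hn : ¬ h ≤ g) : ∃ X, IsDrop ℓ r h X (g X) := by
  have key : ∀ x, g x < h x → x ≤ r n := fun x hx =>
    ((hg.base x (hx.trans_le (hh.le x))).2).trans (hr (hg.le x))
  obtain ⟨x₀, hx₀⟩ : ∃ x, g x < h x := by
    by_contra! hc
    exact hn hc
  have hP : g (Nat.findGreatest (fun x => g x < h x) (r n)) <
      h (Nat.findGreatest (fun x => g x < h x) (r n)) :=
    Nat.findGreatest_spec (P := fun x => g x < h x) (key _ hx₀) hx₀
  have hmax : ∀ x, Nat.findGreatest (fun x => g x < h x) (r n) < x → h x ≤ g x := by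
    intro x hx
    by_contra! hc
    exact absurd (Nat.le_findGreatest (P := fun x => g x < h x) (key x hc) hc) (by omega)
  generalize Nat.findGreatest (fun x => g x < h x) (r n) = X at hP hmax
  have hb := hg.base X (hP.trans_le (hh.le X))
  exact ⟨X, hP, hb.1, hb.2, fun x hx hx' => (hmax x hx).trans (hg.mono hx hx')⟩

theorem IsDrop.exists_maximal {X y : ℕ} (hd : IsDrop ℓ r h X y) :
    ∃ y', y ≤ y' ∧ Maximal (IsDrop ℓ r h X) y' := by
  have hfin : {y | IsDrop ℓ r h X y}.Finite :=
    (Set.finite_Iio (h X)).subset fun y hy => hy.1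
  obtain ⟨y', h1, h2⟩ := hfin.exists_le_maximal hd
  exact ⟨y', h1, h2⟩

end Height

end AltTamari

/-! ### Trees and height functions -/

namespace AltTamari

variable {n : ℕ} {ν : Fin (n + 1) → ℕ} {δ : Fin n → ℕ}

open Classical in
/-- The nodes of the tree whose topmost nodes in the columns are given by `h`. -/
noncomputable def nodes (ν : Fin (n + 1) → ℕ) (δ : Fin n → ℕ) (h : ℕ → ℕ) : Finset (ℕ × ℕ) :=
  {p ∈ points ν δ | p.2 ≤ h p.1 ∧ ∀ x, p.1 < x → x ≤ right ν δ p.2 → h x ≤ p.2}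

theorem mem_nodes (hδ : ∀ i, δ i ≤ ν i.succ) {h : ℕ → ℕ} {p : ℕ × ℕ} :
    p ∈ nodes ν δ h ↔ (p.2 ≤ n ∧ left ν δ p.2 ≤ p.1 ∧ p.1 ≤ right ν δ p.2) ∧
      p.2 ≤ h p.1 ∧ ∀ x, p.1 < x → x ≤ right ν δ p.2 → h x ≤ p.2 := by
  simp only [nodes, Finset.mem_filter, mem_points hδ]

section Nodes

variable {h h' : ℕ → ℕ}

theorem top_mem_nodes (hδ : ∀ i, δ i ≤ ν i.succ) (hh : IsHeight n (left ν δ) (right ν δ) h)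
    {x : ℕ} (hx : x ≤ right ν δ n) : (x, h x) ∈ nodes ν δ h := by
  rw [mem_nodes hδ]
  refine ⟨⟨hh.le x, ?_⟩, le_rfl, fun x' h1 h2 => hh.mono h1 h2⟩
  rcases (hh.le x).lt_or_eq with hlt | heq
  · have := hh.base x hlt
    exact ⟨this.1.le, this.2⟩
  · dsimp only
    rw [heq, left_top hδ]
    exact ⟨Nat.zero_le _, hx⟩

/-- The rightmost column of row `y` with height above `y` works, and no node of the row lies further
west, as this column would exclude it. The strict inequality in `base` makes column `left ν δ y` a
candidate. -/
theorem exists_leftmost (hδ : ∀ i, δ i ≤ ν i.succ) (hh : IsHeight n (left ν δ) (right ν δ) h)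
    {y : ℕ} (hy : y < n) : ∃ x, (x, y) ∈ nodes ν δ h ∧ y < h x := by
  have hl : y < h (left ν δ y) := by
    by_contra! hc
    have h1 := (hh.base (left ν δ y) (by omega)).1
    have h2 := left_anti (ν := ν) (δ := δ) hc
    omega
  have hle := left_le_right (ν := ν) (δ := δ) y
  have h1 := Nat.findGreatest_spec (P := fun x => y < h x) hle hl
  have h2 := Nat.le_findGreatest (P := fun x => y < h x) hle hl
  have h3 := Nat.findGreatest_le (P := fun x => y < h x) (right ν δ y)
  refine ⟨_, ?_, h1⟩
  rw [mem_nodes hδ]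
  refine ⟨⟨hy.le, h2, h3⟩, h1.le, fun x hx hx' => ?_⟩
  by_contra! hc
  exact absurd (Nat.le_findGreatest (P := fun x => y < h x) hx' hc) (not_le.2 hx)

theorem nodes_compatible (hδ : ∀ i, δ i ≤ ν i.succ) {p q : ℕ × ℕ} (hp : p ∈ nodes ν δ h)
    (hq : q ∈ nodes ν δ h) : ¬ Incompatible ν δ p q := by
  rw [mem_nodes hδ] at hp hq
  rw [incompatible_iff hδ hp.1.1 hq.1.1]
  rintro (⟨⟨h1, h2⟩, h3⟩ | ⟨⟨h1, h2⟩, h3⟩)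
  · have := hp.2.2 _ h1 h3
    omega
  · have := hq.2.2 _ h1 h3
    omega

open Classical in
theorem nodes_subset_points : nodes ν δ h ⊆ points ν δ :=
  Finset.filter_subset _ _

/-- This makes node sets maximal. Tops of columns give `h ≤ h'`. If `h'` could drop to `h` in a
column `X`, the leftmost node of row `h X` could lie neither west of `X`, nor in it, nor east of it.
-/
theorem height_eq_of_nodes_subset (hδ : ∀ i, δ i ≤ ν i.succ)
    (hh : IsHeight n (left ν δ) (right ν δ) h) (hh' : IsHeight n (left ν δ) (right ν δ) h')
    (hs : nodes ν δ h ⊆ nodes ν δ h') : h = h' := by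
  refine le_antisymm (fun x => ?_) ?_
  · by_contra! hc
    have h1 := (hh'.base x (hc.trans_le (hh.le x))).2
    have h2 := right_mono (ν := ν) (δ := δ) (hh'.le x)
    have := ((mem_nodes hδ).1 (hs (top_mem_nodes hδ hh (h1.trans h2)))).2.1
    exact absurd this (not_le.2 hc)
  · by_contra hc
    obtain ⟨X, h1, h2, h3, h4⟩ := exists_drop_of_not_le right_mono hh' hh hc
    obtain ⟨x, hx, hx'⟩ := exists_leftmost hδ hh (h1.trans_le (hh'.le X))
    have h5 := (mem_nodes hδ).1 (hs hx)
    have h6 := (mem_nodes hδ).1 hx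
    dsimp only at h5 h6
    rcases lt_trichotomy x X with hlt | rfl | hlt
    · have := h5.2.2 X hlt h3
      omega
    · omega
    · have := hh.mono hlt h6.1.2.2
      omega

/-- Compatibility with `p` places all of `S`, hence the hull, under the test function of `p`. -/
theorem subset_nodes_hull (hδ : ∀ i, δ i ≤ ν i.succ) {S : Finset (ℕ × ℕ)} (hS : S ⊆ points ν δ)
    (hc : ∀ p ∈ S, ∀ q ∈ S, ¬ Incompatible ν δ p q) :
    S ⊆ nodes ν δ (hull n (left ν δ) (right ν δ) S) := by
  have hn : ∀ p ∈ S, p.2 ≤ n := fun p hp => ((mem_points hδ).1 (hS hp)).1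
  intro p hp
  have hp' := (mem_points hδ).1 (hS hp)
  rw [mem_nodes hδ]
  refine ⟨hp', le_hull hn p hp, fun x hx hx' => ?_⟩
  refine (hull_le (isHeight_bound hp'.1 hp'.2.1) (fun q hq => ?_) x).trans
    (by simp only [hx, hx', and_self, if_true, le_refl])
  split_ifs with hif
  · by_contra! hlt
    exact hc p hp q hq ((incompatible_iff hδ hp'.1 (hn q hq)).2 (Or.inl ⟨⟨hif.1, hlt⟩, hif.2⟩))
  · exact hn q hq

theorem isTree_nodes (hδ : ∀ i, δ i ≤ ν i.succ) (hh : IsHeight n (left ν δ) (right ν δ) h) :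
    IsTree ν δ (nodes ν δ h) := by
  refine ⟨⟨nodes_subset_points, fun p hp q hq => nodes_compatible hδ hp hq⟩, ?_⟩
  rintro S ⟨hS, hc⟩ hle
  have h1 := subset_nodes_hull hδ hS hc
  have h2 := height_eq_of_nodes_subset hδ hh
    (isHeight_hull fun p hp => ((mem_points hδ).1 (hS hp)).1) (hle.trans h1)
  rwa [← h2] at h1

end Nodes

/-- The height function of a tree. -/
noncomputable def Tree.height (T : Tree ν δ) : ℕ → ℕ := hull n (left ν δ) (right ν δ) T.1

theorem Tree.isHeight (hδ : ∀ i, δ i ≤ ν i.succ) (T : Tree ν δ) :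
    IsHeight n (left ν δ) (right ν δ) T.height :=
  isHeight_hull fun _ hp => ((mem_points hδ).1 (T.2.prop.1 hp)).1

theorem Tree.nodes_height (hδ : ∀ i, δ i ≤ ν i.succ) (T : Tree ν δ) : nodes ν δ T.height = T.1 :=
  (T.2.eq_of_le (isTree_nodes hδ (T.isHeight hδ)).prop
    (subset_nodes_hull hδ T.2.prop.1 T.2.prop.2)).symm

theorem Tree.mem_iff (hδ : ∀ i, δ i ≤ ν i.succ) (T : Tree ν δ) {p : ℕ × ℕ} :
    p ∈ T.1 ↔ (p.2 ≤ n ∧ left ν δ p.2 ≤ p.1 ∧ p.1 ≤ right ν δ p.2) ∧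
      p.2 ≤ T.height p.1 ∧ ∀ x, p.1 < x → x ≤ right ν δ p.2 → T.height x ≤ p.2 := by
  rw [← T.nodes_height hδ, mem_nodes hδ]

theorem Tree.exists_height_eq (hδ : ∀ i, δ i ≤ ν i.succ) {h : ℕ → ℕ}
    (hh : IsHeight n (left ν δ) (right ν δ) h) : ∃ T : Tree ν δ, T.height = h := by
  let T : Tree ν δ := ⟨nodes ν δ h, isTree_nodes hδ hh⟩
  exact ⟨T, height_eq_of_nodes_subset hδ (T.isHeight hδ) hh (T.nodes_height hδ).subset⟩

theorem Tree.height_injective (hδ : ∀ i, δ i ≤ ν i.succ) {T T' : Tree ν δ}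
    (h : T.height = T'.height) : T = T' :=
  Subtype.ext (by rw [← T.nodes_height hδ, ← T'.nodes_height hδ, h])

/-! ### Rotations -/

theorem height_le_of_isRightRotation (hδ : ∀ i, δ i ≤ ν i.succ) {T T' : Tree ν δ} {q q' : ℕ × ℕ}
    (hrot : IsRightRotation T.1 T'.1 q q') : T.height ≤ T'.height := by
  obtain ⟨p, hp, r, hr, h1, h2, hq, hq', hqT, hs, hT'⟩ := hrot
  refine hull_le (T'.isHeight hδ) fun s hsT => ?_
  have hmem : ∀ t ∈ T.1, t ≠ q → t.2 ≤ T'.height t.1 := fun t ht hne =>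
    ((T'.mem_iff hδ).1 (hT' ▸ Finset.mem_insert_of_mem (Finset.mem_erase.2 ⟨hne, ht⟩))).2.1
  rcases eq_or_ne s q with rfl | hne
  · have := hmem p hp (by rintro rfl; rw [hq] at h2; exact lt_irrefl _ h2)
    rw [hq]
    exact h2.le.trans this
  · exact hmem s hsT hne

theorem drop_of_isRightRotation (hδ : ∀ i, δ i ≤ ν i.succ) {T T' : Tree ν δ} {q q' : ℕ × ℕ}
    (hrot : IsRightRotation T.1 T'.1 q q') :
    T'.height q'.1 = q'.2 ∧ ∃ y, IsDrop (left ν δ) (right ν δ) T'.height q'.1 y := by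
  obtain ⟨p, hp, r, hr, h1, h2, hq, hq', hqT, hs, hT'⟩ := hrot
  have hq'T : q' ∈ T'.1 := hT' ▸ Finset.mem_insert_self _ _
  have hrT : r ∈ T'.1 := hT' ▸ Finset.mem_insert_of_mem
    (Finset.mem_erase.2 ⟨by rintro rfl; rw [hq] at h1; exact lt_irrefl _ h1, hr⟩)
  have e1 := (T'.mem_iff hδ).1 hq'T
  have e2 := (T'.mem_iff hδ).1 hrT
  have e3 := (T.mem_iff hδ).1 hqT
  subst hq hq'
  dsimp only at *
  constructor
  -- A higher top node in this column would already belong to `T`, where it is incompatible with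
  -- `q`.
  · by_contra hne
    have hlt : p.2 < T'.height r.1 := lt_of_le_of_ne e1.2.1 (Ne.symm hne)
    have htop : (r.1, T'.height r.1) ∈ T'.1 := by
      have := top_mem_nodes hδ (T'.isHeight hδ)
        (x := r.1) (e1.1.2.2.trans (right_mono e1.1.1))
      rwa [T'.nodes_height hδ] at this
    rw [hT', Finset.mem_insert, Finset.mem_erase] at htop
    rcases htop with htop | ⟨-, htop⟩
    · simp only [Prod.mk.injEq] at htop
      omega
    · refine T.2.prop.2 _ hqT _ htop ((incompatible_iff (p := (p.1, r.2))
        (q := (r.1, T'.height r.1)) hδ e3.1.1 ((T'.isHeight hδ).le _)).2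
        (Or.inl ⟨⟨h1, h2.trans hlt⟩, e2.1.2.2⟩))
  · exact ⟨r.2, h2.trans_le e1.2.1, lt_of_le_of_lt e3.1.2.1 h1, e2.1.2.2, e2.2.2⟩

/-- The rectangle has rows `y` and `T'.height X` and columns `a` and `X`, where `(a, y)` is the
leftmost node of row `y` in `T`. The columns strictly between are lower than `y`. -/
theorem exists_isRightRotation (hδ : ∀ i, δ i ≤ ν i.succ) {T T' : Tree ν δ} {X y : ℕ}
    (hd : Maximal (IsDrop (left ν δ) (right ν δ) T'.height X) y)
    (hT : T.height = Function.update T'.height X y) :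
    ∃ q, IsRightRotation T.1 T'.1 q (X, T'.height X) := by
  have hh := T'.isHeight hδ
  -- By maximality of `y`, a level strictly between fails to be a drop only through a high column
  -- east of `X`; that column excludes nodes of this level on both vertical sides of the rectangle.
  have hmax : ∀ y', y < y' → y' < T'.height X →
      ∃ x, X < x ∧ x ≤ right ν δ y' ∧ y' < T'.height x := by
    intro y' h1 h2
    by_contra! hc
    have hl := left_anti (ν := ν) (δ := δ) h1.le
    have hr := right_mono (ν := ν) (δ := δ) h1.le
    have := hd.2 (y := y') ⟨h2, lt_of_le_of_lt hl hd.1.2.1, hd.1.2.2.1.trans hr, hc⟩ h1.le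
    omega
  obtain ⟨h1, h2, h3, h4⟩ := hd.prop
  set h := T'.height with hdef
  have hX := hh.le X
  have hTX : T.height X = y := by rw [hT, Function.update_self]
  have hTx : ∀ x, x ≠ X → T.height x = h x := fun x hx => by rw [hT, Function.update_of_ne hx]
  obtain ⟨a, ha, hya⟩ := exists_leftmost hδ (T.isHeight hδ) (y := y) (by omega)
  have ha' := (mem_nodes hδ).1 ha
  rw [T.nodes_height hδ] at ha
  dsimp only at ha'
  have haX : a ≠ X := by rintro rfl; omega
  rw [hTx a haX] at hya
  have haX : a < X := by
    by_contra! hc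
    have := h4 a (by omega) ha'.1.2.2
    omega
  have hha : h X ≤ h a := hh.mono haX (h3.trans (right_mono hya.le))
  have hlow : ∀ x, a < x → x < X → h x < y := by
    intro x hx1 hx2
    have e1 := ha'.2.2 x hx1 (by omega)
    rw [hTx x (by omega)] at e1
    rcases e1.lt_or_eq with e1 | e1
    · exact e1
    · have := hh.mono hx2 (by rw [e1]; exact h3)
      omega
  have hrX : (X, y) ∈ T.1 := by
    rw [T.mem_iff hδ]
    refine ⟨⟨by omega, h2.le, h3⟩, hTX.ge, fun x hx hx' => ?_⟩
    rw [hTx x (by omega)]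
    exact h4 x hx hx'
  have hp : (a, h X) ∈ T.1 := by
    rw [T.mem_iff hδ]
    have e1 := left_anti (ν := ν) (δ := δ) h1.le
    have e2 := right_mono (ν := ν) (δ := δ) h1.le
    refine ⟨⟨hX, by dsimp only; omega, by dsimp only; omega⟩, ?_, fun x hx hx' => ?_⟩
    · rw [hTx a (by omega)]
      exact hha
    · dsimp only at hx hx' ⊢
      rcases lt_trichotomy x X with hlt | rfl | hlt
      · rw [hTx x (by omega)]
        have := hlow x hx hlt
        omega
      · omega
      · rw [hTx x (by omega)]
        exact hh.mono hlt hx'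
  refine ⟨(a, y), (a, h X), hp, (X, y), hrX, haX, h1, rfl, rfl, ha, ?_, ?_⟩
  · rintro ⟨x, z⟩ hs hI
    simp only [Finset.mem_Icc, Prod.mk_le_mk] at hI
    simp only [Prod.mk.injEq]
    have hs' := (T.mem_iff hδ).1 hs
    dsimp only at hs'
    have hxX : x ≠ X → x = a := by
      intro hne
      by_contra hna
      have := hlow x (by omega) (by omega)
      rw [hTx x hne] at hs'
      omega
    by_cases hx : x = X
    · subst hx
      have : z = y := by omega
      tauto
    · have := hxX hx
      subst this
      by_contra hc
      obtain ⟨x', k1, k2, k3⟩ := hmax z (by omega) (by omega)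
      have := hs'.2.2 x' (by omega) k2
      rw [hTx x' (by omega)] at this
      omega
  · ext ⟨x, z⟩
    rw [Finset.mem_insert, Finset.mem_erase, T'.mem_iff hδ, T.mem_iff hδ, ← hdef]
    simp only [Prod.mk.injEq, ne_eq]
    constructor
    · rintro ⟨k1, k2, k3⟩
      by_cases hz : x = X ∧ z = h X
      · exact Or.inl hz
      refine Or.inr ⟨?_, k1, ?_, fun x' hx hx' => ?_⟩
      · rintro ⟨rfl, rfl⟩
        have := k3 X haX h3
        omega
      · by_cases hx : x = X
        · subst hx
          by_contra! hc
          obtain ⟨x', e1, e2, e3⟩ := hmax z (by omega) (by omega)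
          have := k3 x' e1 e2
          omega
        · rwa [hTx x hx]
      · by_cases hxX : x' = X
        · subst hxX
          have := k3 x' hx hx'
          omega
        · rw [hTx x' hxX]
          exact k3 x' hx hx'
    · rintro (⟨rfl, rfl⟩ | ⟨hne, k1, k2, k3⟩)
      · have := (mem_nodes hδ).1
          (top_mem_nodes hδ hh (x := x) (h3.trans (right_mono (by omega))))
        exact this
      · refine ⟨k1, ?_, fun x' hx hx' => ?_⟩
        · by_cases hx : x = X
          · subst hx; omega
          · rwa [hTx x hx] at k2
        · by_cases hxX : x' = X
          · subst hxX
            have hyz := k3 x' hx hx'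
            by_contra! hc
            have hzy : z ≠ y := by
              rintro rfl
              rcases lt_trichotomy x a with hlt | rfl | hlt
              · have := k3 a hlt ha'.1.2.2
                rw [hTx a (by omega)] at this
                omega
              · simp at hne
              · have := hlow x hlt hx
                rw [hTx x (by omega)] at k2
                omega
            obtain ⟨x'', e1, e2, e3⟩ := hmax z (by omega) (by omega)
            have := k3 x'' (by omega) e2
            rw [hTx x'' (by omega)] at this
            omega
          · have := k3 x' hx hx'
            rwa [hTx x' hxX] at this

theorem Tree.le_iff (hδ : ∀ i, δ i ≤ ν i.succ) {T T' : Tree ν δ} :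
    T ≤ T' ↔ T.height ≤ T'.height := by
  constructor
  · intro h
    change Relation.ReflTransGen Tree.RotatesTo T T' at h
    induction h with
    | refl => exact le_rfl
    | tail _ hr ih =>
      obtain ⟨q, q', hr⟩ := hr
      exact ih.trans (height_le_of_isRightRotation hδ hr)
  -- Undo one rotation of `T'` in a column where it exceeds `T`, lowering as little as possible so
  -- as to stay above `T`; the sum of the node heights decreases.
  · induction hk : ∑ s ∈ T'.1, s.2 using Nat.strong_induction_on generalizing T' with
    | _ k ih =>
    intro hle
    by_cases hge : T'.height ≤ T.height
    · rw [Tree.height_injective hδ (le_antisymm hle hge)]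
    obtain ⟨X, hX⟩ := exists_drop_of_not_le right_mono (T'.isHeight hδ) (T.isHeight hδ) hge
    obtain ⟨y, hy, hmax⟩ := hX.exists_maximal
    obtain ⟨T₁, hT₁⟩ := Tree.exists_height_eq hδ (hmax.prop.isHeight_update (T'.isHeight hδ))
    obtain ⟨q, hrot⟩ := exists_isRightRotation hδ hmax hT₁
    have hr : T₁.RotatesTo T' := ⟨_, _, hrot⟩
    have hle₁ : T ≤ T₁ := by
      refine ih _ (hk ▸ hr.sum_lt) rfl ?_
      rw [hT₁]
      exact le_update_iff.2 ⟨hy, fun x _ => hle x⟩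
    exact Relation.ReflTransGen.tail hle₁ hr

end AltTamari

/-! ### Canonical join representations of trees -/

namespace CanonicalJoin

variable {α : Type*} [PartialOrder α]

/-- Mutual refinement gives `x ≤ y ≤ z` with `y ∈ B` and `z ∈ A`; if `z ≠ x`, then `x` would be
redundant in `A`. -/
theorem IsCanonicalJoinRep.subset {A B : Finset α} {a : α} (hA : IsCanonicalJoinRep A a)
    (hB : IsCanonicalJoinRep B a) : A ⊆ B := by
  classical
  intro x hx
  obtain ⟨y, hy, hxy⟩ := hA.2.2 B hB.1 x hx
  obtain ⟨z, hz, hyz⟩ := hB.2.2 A hA.1 y hy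
  by_cases hxz : x = z
  · rwa [le_antisymm hxy (hxz ▸ hyz)]
  refine absurd ?_ (hA.2.1 _ (Finset.erase_ssubset hx))
  refine ⟨fun w hw => hA.1.2.1 (Finset.mem_of_mem_erase hw), fun b hb => hA.1.2.2 fun w hw => ?_⟩
  by_cases hwx : w = x
  · subst hwx
    exact (hxy.trans hyz).trans (hb (Finset.mem_coe.2 (Finset.mem_erase.2 ⟨Ne.symm hxz, hz⟩)))
  · exact hb (Finset.mem_coe.2 (Finset.mem_erase.2 ⟨hwx, hw⟩))

theorem IsCanonicalJoinRep.unique {A B : Finset α} {a : α} (hA : IsCanonicalJoinRep A a)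
    (hB : IsCanonicalJoinRep B a) : A = B :=
  (hA.subset hB).antisymm (hB.subset hA)

end CanonicalJoin

namespace AltTamari

open CanonicalJoin

variable {n : ℕ} {ν : Fin (n + 1) → ℕ} {δ : Fin n → ℕ}

/-- The least height function that reaches the north-east corners of the boxes in `S`. -/
noncomputable def boxHull (ν : Fin (n + 1) → ℕ) (δ : Fin n → ℕ) (S : Finset (ℕ × ℕ)) : ℕ → ℕ :=
  hull n (left ν δ) (right ν δ) (S.image fun b => (b.1 + 1, b.2 + 1))

section BoxHull

variable {S : Finset (ℕ × ℕ)}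

theorem snd_le_of_mem_image (hS : ∀ b ∈ S, b.2 < n) :
    ∀ p ∈ S.image fun b => (b.1 + 1, b.2 + 1), p.2 ≤ n := by
  intro p hp
  obtain ⟨b, hb, rfl⟩ := Finset.mem_image.1 hp
  exact hS b hb

theorem isHeight_boxHull (hS : ∀ b ∈ S, b.2 < n) :
    IsHeight n (left ν δ) (right ν δ) (boxHull ν δ S) :=
  isHeight_hull (snd_le_of_mem_image hS)

theorem lt_boxHull (hS : ∀ b ∈ S, b.2 < n) {b : ℕ × ℕ} (hb : b ∈ S) :
    b.2 < boxHull ν δ S (b.1 + 1) :=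
  le_hull (n := n) (ℓ := left ν δ) (r := right ν δ)
    (snd_le_of_mem_image hS) _ (Finset.mem_image_of_mem (fun b : ℕ × ℕ => (b.1 + 1, b.2 + 1)) hb)

theorem boxHull_le {h : ℕ → ℕ} (hh : IsHeight n (left ν δ) (right ν δ) h)
    (hS : ∀ b ∈ S, b.2 < h (b.1 + 1)) : boxHull ν δ S ≤ h := by
  refine hull_le hh fun p hp => ?_
  obtain ⟨b, hb, rfl⟩ := Finset.mem_image.1 hp
  exact hS b hb

end BoxHull

/-- The box `b` lies just above the lowest position to which the node on top of the column of its
north-east corner can be rotated back. -/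
def Tree.IsCanonicalBox (T : Tree ν δ) (b : ℕ × ℕ) : Prop :=
  Maximal (IsDrop (left ν δ) (right ν δ) T.height (b.1 + 1)) b.2

theorem Tree.IsCanonicalBox.mem_boxes (hδ : ∀ i, δ i ≤ ν i.succ) {T : Tree ν δ} {b : ℕ × ℕ}
    (hb : T.IsCanonicalBox b) : b ∈ boxes ν δ := by
  obtain ⟨h1, h2, h3, -⟩ := hb.prop
  rw [AltTamari.mem_boxes hδ]
  have := (T.isHeight hδ).le (b.1 + 1)
  omega

theorem IsDrop.exists_canonicalBox {T : Tree ν δ} {X y : ℕ}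
    (hd : IsDrop (left ν δ) (right ν δ) T.height X y) :
    ∃ y', y ≤ y' ∧ T.IsCanonicalBox (X - 1, y') := by
  obtain ⟨y', h1, h2⟩ := hd.exists_maximal
  have : X - 1 + 1 = X := by have := hd.2.1; omega
  exact ⟨y', h1, by unfold Tree.IsCanonicalBox; dsimp only; rwa [this]⟩

theorem Tree.IsCanonicalBox.snd_unique {T : Tree ν δ} {x y y' : ℕ}
    (h : T.IsCanonicalBox (x, y)) (h' : T.IsCanonicalBox (x, y')) : y = y' := by
  rcases le_total y y' with hy | hy
  · exact h.eq_of_le h'.prop hy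
  · exact (h'.eq_of_le h.prop hy).symm

open Classical in
/-- The finite set of canonical boxes of a tree. -/
noncomputable def Tree.canonicalBoxes (T : Tree ν δ) : Finset (ℕ × ℕ) :=
  {b ∈ boxes ν δ | T.IsCanonicalBox b}

theorem Tree.mem_canonicalBoxes (hδ : ∀ i, δ i ≤ ν i.succ) {T : Tree ν δ} {b : ℕ × ℕ} :
    b ∈ T.canonicalBoxes ↔ T.IsCanonicalBox b := by
  simp only [canonicalBoxes, Finset.mem_filter, and_iff_right_iff_imp]
  exact fun h => h.mem_boxes hδ

/-- If two boxes in different columns were incompatible, the drop at the western box would bound the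
eastern column by the western level, leaving no room for the drop there. -/
theorem Tree.IsCanonicalBox.compatible (hδ : ∀ i, δ i ≤ ν i.succ) {T : Tree ν δ} {a b : ℕ × ℕ}
    (ha : T.IsCanonicalBox a) (hb : T.IsCanonicalBox b) : ¬ BoxIncompatible ν δ a b := by
  have key : ∀ {a b : ℕ × ℕ}, T.IsCanonicalBox a → T.IsCanonicalBox b → a.1 < b.1 →
      a.2 ≤ b.2 → b.1 < right ν δ a.2 → False := by
    intro a b ha hb h1 h2 h3
    have := ha.prop.2.2.2 (b.1 + 1) (by omega) (by omega)
    have := hb.prop.1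
    omega
  rw [boxIncompatible_iff hδ (ha.mem_boxes hδ) (hb.mem_boxes hδ)]
  have ha' := (AltTamari.mem_boxes hδ).1 (ha.mem_boxes hδ)
  have hb' := (AltTamari.mem_boxes hδ).1 (hb.mem_boxes hδ)
  rintro ⟨hne, h | h | ⟨h1, h2, h3⟩ | ⟨h1, h2, h3⟩⟩
  · obtain ⟨a1, a2⟩ := a
    obtain ⟨b1, b2⟩ := b
    dsimp only at h
    subst h
    exact hne (by rw [ha.snd_unique hb])
  · rcases lt_trichotomy a.1 b.1 with hlt | heq | hlt
    · exact key ha hb hlt h.le (by rw [h]; exact hb'.2.2)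
    · exact hne (Prod.ext heq h)
    · exact key hb ha hlt h.ge (by rw [← h]; exact ha'.2.2)
  · exact key ha hb h1 h2.le h3
  · exact key hb ha h1 h2.le h3

theorem Tree.height_le_of_canonical (hδ : ∀ i, δ i ≤ ν i.succ) (T : Tree ν δ) {g : ℕ → ℕ}
    (hg : IsHeight n (left ν δ) (right ν δ) g)
    (h : ∀ b, T.IsCanonicalBox b → b.2 < g (b.1 + 1)) : T.height ≤ g := by
  by_contra hc
  obtain ⟨X, hX⟩ := exists_drop_of_not_le right_mono (T.isHeight hδ) hg hc
  obtain ⟨y, hy, hb⟩ := hX.exists_canonicalBox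
  have := h _ hb
  have hX0 := hX.2.1
  rw [show X - 1 + 1 = X by omega] at this
  omega

theorem canonicalBox_iff_mem (hδ : ∀ i, δ i ≤ ν i.succ) {S : Finset (ℕ × ℕ)}
    (hS : S ⊆ boxes ν δ) (hc : ∀ a ∈ S, ∀ b ∈ S, ¬ BoxIncompatible ν δ a b) {T : Tree ν δ}
    (hT : T.height = boxHull ν δ S) {b : ℕ × ℕ} : T.IsCanonicalBox b ↔ b ∈ S := by
  have hn : ∀ b ∈ S, b.2 < n := fun b hb => ((mem_boxes hδ).1 (hS hb)).1
  have hcol : ∀ a ∈ S, ∀ b ∈ S, a.1 = b.1 → a = b := by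
    intro a ha b hb hab
    by_contra hne
    exact hc a ha b hb ⟨hne, Or.inl hab⟩
  -- Otherwise the lowered function would still reach all boxes of `S`, against the leastness of the
  -- hull.
  have hmin : ∀ X y, IsDrop (left ν δ) (right ν δ) T.height X y →
      ∃ c ∈ S, c.1 + 1 = X ∧ y ≤ c.2 := by
    intro X y hd
    by_contra! hno
    have hle := boxHull_le (S := S) (hd.isHeight_update (T.isHeight hδ)) (fun c hcS => by
      by_cases hX : c.1 + 1 = X
      · subst hX
        rw [Function.update_self]
        exact hno c hcS rfl
      · rw [Function.update_of_ne hX, hT]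
        exact lt_boxHull hn hcS) X
    rw [← hT, Function.update_self] at hle
    exact absurd hle (not_le.2 hd.1)
  -- Compatibility with `c` puts the corners of all boxes of `S` under the test function at `(c.1 +
  -- 1, c.2)`.
  have hdrop : ∀ c ∈ S, IsDrop (left ν δ) (right ν δ) T.height (c.1 + 1) c.2 := by
    intro c hcS
    have hcb := (mem_boxes hδ).1 (hS hcS)
    refine ⟨hT ▸ lt_boxHull hn hcS, by omega, by omega, fun x hx hx' => ?_⟩
    rw [hT]
    refine (boxHull_le (S := S) (isHeight_bound (r := right ν δ) (a := c.1 + 1) hcb.1.le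
      (by omega)) (fun d hd => ?_) x).trans (by simp only [hx, hx', and_self, if_true, le_refl])
    split_ifs with hif
    · by_contra! hlt
      refine hc c hcS d hd ((boxIncompatible_iff hδ (hS hcS) (hS hd)).2 ⟨?_, ?_⟩)
      · rintro rfl; omega
      · omega
    · exact hn d hd
  constructor
  · intro hb
    obtain ⟨c, hcS, h1, h2⟩ := hmin _ _ hb.prop
    have h3 := hdrop c hcS
    rw [h1] at h3
    have h4 : b.2 = c.2 := hb.eq_of_le h3 h2
    have : b = c := Prod.ext (by omega) h4
    rwa [this]
  · refine fun hb => ⟨hdrop b hb, fun y hy _ => ?_⟩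
    obtain ⟨c, hcS, h1, h2⟩ := hmin _ _ hy
    rwa [hcol b hb c hcS (by omega)]

/-- The join-irreducible tree of a box (an arbitrary tree if `b` is not a box). -/
noncomputable def boxTree (hδ : ∀ i, δ i ≤ ν i.succ) (b : ℕ × ℕ) : Tree ν δ :=
  if hb : b.2 < n then
    (Tree.exists_height_eq hδ (isHeight_boxHull (S := {b}) (by simpa using hb))).choose
  else (Tree.exists_height_eq hδ isHeight_const).choose

variable {hδ : ∀ i, δ i ≤ ν i.succ} {b : ℕ × ℕ}

theorem height_boxTree (hb : b ∈ boxes ν δ) : (boxTree hδ b).height = boxHull ν δ {b} := by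
  have hn := ((mem_boxes hδ).1 hb).1
  rw [boxTree, dif_pos hn]
  exact (Tree.exists_height_eq hδ (isHeight_boxHull (S := {b}) (by simpa using hn))).choose_spec

theorem boxTree_le_iff (hb : b ∈ boxes ν δ) {T : Tree ν δ} :
    boxTree hδ b ≤ T ↔ b.2 < T.height (b.1 + 1) := by
  have hn : ∀ c ∈ ({b} : Finset (ℕ × ℕ)), c.2 < n := by
    simpa using ((mem_boxes hδ).1 hb).1
  rw [Tree.le_iff hδ, height_boxTree hb]
  constructor
  · exact fun h => (lt_boxHull hn (Finset.mem_singleton_self b)).trans_le (h _)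
  · exact fun h => boxHull_le (T.isHeight hδ) (by simpa using h)

theorem isCanonicalBox_boxTree (hb : b ∈ boxes ν δ) {c : ℕ × ℕ} :
    (boxTree hδ b).IsCanonicalBox c ↔ c = b := by
  rw [canonicalBox_iff_mem hδ (S := {b}) (by simpa using hb) (by simp [BoxIncompatible])
    (height_boxTree hb), Finset.mem_singleton]

theorem boxTree_injOn : Set.InjOn (boxTree hδ) (boxes ν δ) := fun b hb c hc h => by
  have : (boxTree hδ b).IsCanonicalBox b := (isCanonicalBox_boxTree hb).2 rfl
  rw [h] at this
  exact (isCanonicalBox_boxTree hc).1 this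

/-- The lower cover of a tree that belongs to a canonical box. -/
theorem Tree.IsCanonicalBox.exists_lower (hδ : ∀ i, δ i ≤ ν i.succ) {T : Tree ν δ}
    (hb : T.IsCanonicalBox b) :
    ∃ T' : Tree ν δ, T' < T ∧ T'.height = Function.update T.height (b.1 + 1) b.2 := by
  obtain ⟨T', hT'⟩ := Tree.exists_height_eq hδ (hb.prop.isHeight_update (T.isHeight hδ))
  refine ⟨T', lt_of_le_of_ne ((Tree.le_iff hδ).2 ?_) ?_, hT'⟩
  · rw [hT']
    exact update_le_iff.2 ⟨hb.prop.1.le, fun _ _ => le_rfl⟩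
  · rintro rfl
    have h1 := congrFun hT' (b.1 + 1)
    rw [Function.update_self] at h1
    exact hb.prop.1.ne' h1

/-- Every strictly smaller tree has height at most `b.2` in column `b.1 + 1`, so it lies below the
one lower cover at `b`. -/
theorem isJoinIrr_boxTree (hb : b ∈ boxes ν δ) : IsJoinIrr (boxTree hδ b) := by
  have hcan : (boxTree hδ b).IsCanonicalBox b := (isCanonicalBox_boxTree hb).2 rfl
  obtain ⟨T', hlt, hT'⟩ := hcan.exists_lower hδ
  have hle : ∀ T, T < boxTree hδ b → T ≤ T' := by
    intro T hT
    have hT1 := (Tree.le_iff hδ).1 hT.le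
    have : ¬ boxTree hδ b ≤ T := not_le_of_gt hT
    rw [boxTree_le_iff hb, not_lt] at this
    rw [Tree.le_iff hδ, hT']
    exact le_update_iff.2 ⟨this, fun x _ => hT1 x⟩
  refine ⟨T', ⟨hlt, fun T h1 h2 => absurd (hle T h2) (not_le_of_gt h1)⟩, fun T hT => ?_⟩
  by_contra hne
  exact hT.2 (lt_of_le_of_ne (hle T hT.1) hne) hlt

-- The lower cover at `b` bounds the trees of all other canonical boxes, whence irredundancy. It
-- also bounds any family below `T` without a member above the tree of `b`, whence refinement.
open Classical in
theorem isCanonicalJoinRep_canonicalBoxes (T : Tree ν δ) :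
    IsCanonicalJoinRep (T.canonicalBoxes.image (boxTree hδ)) T := by
  have hmem : ∀ {b}, b ∈ T.canonicalBoxes ↔ T.IsCanonicalBox b := Tree.mem_canonicalBoxes hδ
  have hupper : ∀ b, T.IsCanonicalBox b → boxTree hδ b ≤ T := fun b hb =>
    (boxTree_le_iff (hb.mem_boxes hδ)).2 hb.prop.1
  refine ⟨⟨?_, ?_, ?_⟩, ?_, ?_⟩
  · intro j hj
    obtain ⟨b, hb, rfl⟩ := Finset.mem_image.1 hj
    exact isJoinIrr_boxTree ((hmem.1 hb).mem_boxes hδ)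
  · intro j hj
    obtain ⟨b, hb, rfl⟩ := Finset.mem_image.1 (Finset.mem_coe.1 hj)
    exact hupper b (hmem.1 hb)
  · intro U hU
    refine (Tree.le_iff hδ).2 (T.height_le_of_canonical hδ (U.isHeight hδ) fun b hb => ?_)
    exact (boxTree_le_iff (hb.mem_boxes hδ)).1
      (hU (Finset.mem_coe.2 (Finset.mem_image_of_mem _ (hmem.2 hb))))
  · intro B hB hlub
    obtain ⟨j, hj, hjB⟩ := Finset.exists_of_ssubset hB
    obtain ⟨b, hb, rfl⟩ := Finset.mem_image.1 hj
    obtain ⟨T', hlt, hT'⟩ := (hmem.1 hb).exists_lower hδ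
    refine not_le_of_gt hlt (hlub.2 fun k hk => ?_)
    obtain ⟨c, hc, rfl⟩ := Finset.mem_image.1 (hB.1 hk)
    rw [boxTree_le_iff ((hmem.1 hc).mem_boxes hδ), hT', Function.update_of_ne]
    · exact (hmem.1 hc).prop.1
    · intro heq
      have : c = b := by
        obtain ⟨c1, c2⟩ := c
        obtain ⟨b1, b2⟩ := b
        obtain rfl : c1 = b1 := by simpa using heq
        rw [(hmem.1 hc).snd_unique (hmem.1 hb)]
      exact hjB (this ▸ hk)
  · intro B hB j hj
    obtain ⟨b, hb, rfl⟩ := Finset.mem_image.1 hj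
    obtain ⟨T', hlt, hT'⟩ := (hmem.1 hb).exists_lower hδ
    by_contra! hno
    refine not_le_of_gt hlt (hB.2.2 fun k hk => ?_)
    have h1 := (Tree.le_iff hδ).1 (hB.2.1 hk)
    have h2 := hno k hk
    rw [boxTree_le_iff ((hmem.1 hb).mem_boxes hδ), not_lt] at h2
    rw [Tree.le_iff hδ, hT']
    exact le_update_iff.2 ⟨h2, fun x _ => h1 x⟩

open Classical in
/-- The faces of the canonical join complex are the sets of pairwise compatible boxes. -/
theorem mem_canonicalJoinComplex_iff {A : Finset (Tree ν δ)} :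
    A ∈ canonicalJoinComplex ν δ ↔ ∃ S : Finset (ℕ × ℕ), (S ⊆ boxes ν δ ∧
      ∀ a ∈ S, ∀ b ∈ S, ¬ BoxIncompatible ν δ a b) ∧ S.image (boxTree hδ) = A := by
  constructor
  -- Uniqueness of canonical join representations makes a classification of all join-irreducible
  -- trees unnecessary.
  · rintro ⟨T, hT⟩
    refine ⟨T.canonicalBoxes, ⟨fun b hb => ((T.mem_canonicalBoxes hδ).1 hb).mem_boxes hδ,
      fun a ha b hb => ?_⟩, (isCanonicalJoinRep_canonicalBoxes T).unique hT⟩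
    exact ((T.mem_canonicalBoxes hδ).1 ha).compatible hδ ((T.mem_canonicalBoxes hδ).1 hb)
  · rintro ⟨S, ⟨hS, hc⟩, rfl⟩
    obtain ⟨T, hT⟩ := Tree.exists_height_eq hδ
      (isHeight_boxHull (S := S) fun b hb => ((mem_boxes hδ).1 (hS hb)).1)
    have : T.canonicalBoxes = S := by
      ext b
      rw [T.mem_canonicalBoxes hδ, canonicalBox_iff_mem hδ hS hc hT]
    exact ⟨T, this ▸ isCanonicalJoinRep_canonicalBoxes T⟩

/-! ### Descents of the join-irreducible trees of boxes. -/

theorem height_boxTree_self (hb : b ∈ boxes ν δ) :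
    (boxTree hδ b).height (b.1 + 1) = b.2 + 1 := by
  have hb' := (mem_boxes hδ).1 hb
  have hcan : (boxTree hδ b).IsCanonicalBox b := (isCanonicalBox_boxTree hb).2 rfl
  by_contra hne
  have hlt := hcan.prop.1
  have hle := left_anti (ν := ν) (δ := δ) (Nat.le_add_right b.2 1)
  have hre := right_mono (ν := ν) (δ := δ) (Nat.le_add_right b.2 1)
  -- A column reaching above `b.2 + 1` could be lowered to `b.2 + 1`, against the maximality of
  -- `b.2`.
  have hd : IsDrop (left ν δ) (right ν δ) (boxTree hδ b).height (b.1 + 1) (b.2 + 1) := by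
    refine ⟨by omega, by omega, by omega, fun x hx hx' => ?_⟩
    rw [height_boxTree hb]
    refine (boxHull_le (S := {b}) (isHeight_bound (r := right ν δ) (a := b.1 + 1) (b := b.2 + 1) hb'.1
      (by omega)) ?_ x).trans (by simp only [hx, hx', and_self, if_true, le_refl])
    simpa using hb'.1
  have := hcan.2 hd (Nat.le_succ _)
  omega

theorem isDescent_boxTree_iff (hb : b ∈ boxes ν δ) {c : ℕ × ℕ} :
    (boxTree hδ b).IsDescent (c.1 + 1, c.2 + 1) ↔ c = b := by
  constructor
  -- A descent tops a column that can be lowered, and only the column of `b` can.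
  · rintro ⟨T, q, hrot⟩
    obtain ⟨h1, y, hd⟩ := drop_of_isRightRotation hδ hrot
    obtain ⟨y', -, hcan⟩ := hd.exists_canonicalBox
    have := (isCanonicalBox_boxTree hb).1 hcan
    have e1 : c.1 = b.1 := by simpa using congrArg Prod.fst this
    dsimp only at h1
    rw [e1, height_boxTree_self hb] at h1
    exact Prod.ext e1 (by omega)
  · rintro rfl
    have hcan : (boxTree hδ c).IsCanonicalBox c := (isCanonicalBox_boxTree hb).2 rfl
    obtain ⟨T', -, hT'⟩ := hcan.exists_lower hδ
    obtain ⟨q, hrot⟩ := exists_isRightRotation hδ hcan hT'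
    rw [height_boxTree_self hb] at hrot
    exact ⟨T', q, hrot⟩

open Classical in
theorem faceBoxes_image_boxTree {S : Finset (ℕ × ℕ)} (hS : S ⊆ boxes ν δ) :
    faceBoxes (S.image (boxTree hδ)) = S := by
  ext c
  simp only [faceBoxes, Finset.mem_image, Set.mem_ofPred_eq, Finset.mem_coe]
  constructor
  · rintro ⟨T, ⟨b, hb, rfl⟩, hd⟩
    rwa [(isDescent_boxTree_iff (hS hb)).1 hd]
  · exact fun hc => ⟨_, ⟨c, hc, rfl⟩, (isDescent_boxTree_iff (hS hc)).2 rfl⟩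

end AltTamari

/-! ### Shellings of independence complexes -/

namespace Shelling

variable {V : Type*}

/-- The complex of the independent subsets of `W` in a graph. -/
def independent (adj : V → V → Prop) (W : Finset V) : Set (Finset V) :=
  {S | S ⊆ W ∧ ∀ a ∈ S, ∀ b ∈ S, ¬ adj a b}

theorem exists_facet_of_independent {adj : V → V → Prop} {W S : Finset V} (hS : S ∈ independent adj W) :
    ∃ G, S ⊆ G ∧ IsFacet (independent adj W) G := by
  have hfin : (independent adj W).Finite :=
    (W.powerset.finite_toSet).subset fun S hS => Finset.mem_coe.2 (Finset.mem_powerset.2 hS.1)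
  exact hfin.exists_le_maximal hS

variable [DecidableEq V]

/-- `L` can be appended to a list with the members `A` such that each member of `L` satisfies the
shelling condition with respect to the facets before it. -/
def Extends : Set (Finset V) → List (Finset V) → Prop
  | _, [] => True
  | A, F :: L => (∀ F' ∈ A, ∃ F'' ∈ A, ∃ x ∈ F, x ∉ F' ∧ F.erase x ⊆ F'') ∧
      Extends (insert F A) L

theorem extends_append {A : Set (Finset V)} {L L' : List (Finset V)} :
    Extends A (L ++ L') ↔ Extends A L ∧ Extends (A ∪ {F | F ∈ L}) L' := by
  induction L generalizing A with
  | nil => simp [Extends]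
  | cons F L ih =>
    have : insert F A ∪ {G | G ∈ L} = A ∪ {G | G ∈ F :: L} := by
      ext G
      simp only [Set.mem_union, Set.mem_insert_iff, Set.mem_ofPred_eq, List.mem_cons]
      tauto
    simp only [List.cons_append, Extends, ih, and_assoc, this]

theorem Extends.nodup {A : Set (Finset V)} {L : List (Finset V)} (h : Extends A L) :
    L.Nodup ∧ ∀ F ∈ L, F ∉ A := by
  induction L generalizing A with
  | nil => simp
  | cons F L ih =>
    obtain ⟨h1, h2⟩ := h
    obtain ⟨h3, h4⟩ := ih h2
    refine ⟨List.nodup_cons.2 ⟨fun hF => h4 F hF (Set.mem_insert _ _), h3⟩, fun G hG hGA => ?_⟩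
    rcases List.mem_cons.1 hG with rfl | hG
    · obtain ⟨_, _, x, hx, hx', _⟩ := h1 G hGA
      exact hx' hx
    · exact h4 G hG (Set.mem_insert_of_mem _ hGA)

/-- Against a facet in `A`, outside the block of `v`, the vertex to remove is `v`, and `hLA`
applies; within the block the exchange in `L` is used. -/
theorem Extends.map_insert {A B : Set (Finset V)} {L : List (Finset V)} {v : V}
    (h : Extends B L) (hv : ∀ F ∈ L, v ∉ F) (hA : ∀ F ∈ A, v ∉ F)
    (hLA : A.Nonempty → ∀ F ∈ L, ∃ F' ∈ A, F ⊆ F') :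
    Extends (A ∪ insert v '' B) (L.map (insert v)) := by
  induction L generalizing B with
  | nil => trivial
  | cons F L ih =>
    obtain ⟨h1, h2⟩ := h
    have hvF : v ∉ F := hv F List.mem_cons_self
    refine ⟨?_, ?_⟩
    · rintro F' (hF' | ⟨G, hG, rfl⟩)
      · obtain ⟨F'', hF'', hs⟩ := hLA ⟨_, hF'⟩ F List.mem_cons_self
        exact ⟨F'', Or.inl hF'', v, Finset.mem_insert_self _ _, hA _ hF',
          by rwa [Finset.erase_insert hvF]⟩
      · obtain ⟨F'', hF'', x, hx, hxG, hs⟩ := h1 G hG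
        have hxv : x ≠ v := by rintro rfl; exact hvF hx
        refine ⟨_, Or.inr ⟨F'', hF'', rfl⟩, x, Finset.mem_insert_of_mem hx,
          by simp [hxv, hxG], ?_⟩
        rw [Finset.erase_insert_of_ne hxv.symm]
        exact Finset.insert_subset_insert _ hs
    · have := ih h2 (fun G hG => hv G (List.mem_cons_of_mem _ hG))
        (fun hne G hG => hLA hne G (List.mem_cons_of_mem _ hG))
      rwa [Set.image_insert_eq, Set.union_insert] at this

theorem Extends.getElem {A : Set (Finset V)} {L : List (Finset V)} (h : Extends A L) (j : ℕ)
    (hj : j < L.length) (F' : Finset V) (hF' : F' ∈ A ∨ ∃ i, ∃ hi : i < j, L[i] = F') :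
    ∃ F'', (F'' ∈ A ∨ ∃ i, ∃ hi : i < j, L[i] = F'') ∧ ∃ x ∈ L[j], x ∉ F' ∧
      L[j].erase x ⊆ F'' := by
  induction L generalizing A j with
  | nil => simp at hj
  | cons F L ih =>
    obtain ⟨h1, h2⟩ := h
    cases j with
    | zero =>
      rcases hF' with hF' | ⟨i, hi, _⟩
      · obtain ⟨F'', hF'', h3⟩ := h1 F' hF'
        exact ⟨F'', Or.inl hF'', h3⟩
      · omega
    | succ j =>
      have hj' : j < L.length := by simpa using hj
      obtain ⟨F'', hF'', h3⟩ := ih h2 j hj' (by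
        rcases hF' with hF' | ⟨i, hi, rfl⟩
        · exact Or.inl (Set.mem_insert_of_mem _ hF')
        · cases i with
          | zero => exact Or.inl (Set.mem_insert _ _)
          | succ i => exact Or.inr ⟨i, by omega, rfl⟩)
      refine ⟨F'', ?_, h3⟩
      rcases hF'' with (rfl | hF'') | ⟨i, hi, rfl⟩
      · exact Or.inr ⟨0, by omega, rfl⟩
      · exact Or.inl hF''
      · exact Or.inr ⟨i + 1, by omega, rfl⟩

/-- A list of the facets of `K` that satisfies the shelling condition. -/
def IsShellingList (K : Set (Finset V)) (L : List (Finset V)) : Prop :=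
  (∀ G, IsFacet K G ↔ G ∈ L) ∧ Extends ∅ L

/-- A common face of `F j` and an earlier facet omits the exchanged vertex `x`, so it lies in `F j`
without `x`. This set is itself a common face, hence equal to any maximal one that it contains. -/
theorem IsShellingList.isShelling {W : Type*} [DecidableEq W] {K : Set (Finset V)} {K' : Set (Finset W)}
    {L : List (Finset V)} (hL : IsShellingList K L) {U : Finset V} (hU : ∀ S ∈ K, S ⊆ U)
    {f : V → W} (hf : Set.InjOn f U) (hK : ∀ A, A ∈ K' ↔ ∃ S ∈ K, S.image f = A) {m : ℕ}
    (hm : m + 1 = L.length) :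
    IsShelling K' fun i : Fin (m + 1) => (L[i.val]'(hm ▸ i.2)).image f := by
  have hsub : ∀ {S T : Finset V}, S ⊆ U → T ⊆ U → (S.image f ⊆ T.image f ↔ S ⊆ T) := by
    intro S T hS hT
    refine ⟨fun h x hx => ?_, fun h => Finset.image_subset_image h⟩
    obtain ⟨y, hy, hxy⟩ := Finset.mem_image.1 (h (Finset.mem_image_of_mem f hx))
    rwa [← hf (hT hy) (hS hx) hxy]
  have hLU : ∀ F ∈ L, F ⊆ U := fun F hF => hU F ((hL.1 F).2 hF).prop
  have hgU : ∀ i (hi : i < L.length), L[i] ⊆ U := fun i hi => hLU _ (List.getElem_mem hi)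
  refine ⟨fun i j hij => ?_, fun G => ⟨fun hG => ?_, ?_⟩, fun j hj => ?_⟩
  · have h1 : L[i.val]'(hm ▸ i.2) = L[j.val]'(hm ▸ j.2) :=
      ((hsub (hgU _ _) (hgU _ _)).1 hij.le).antisymm ((hsub (hgU _ _) (hgU _ _)).1 hij.ge)
    exact Fin.ext ((hL.2.nodup.1.getElem_inj_iff).1 h1)
  · obtain ⟨S, hS, rfl⟩ := (hK G).1 hG.prop
    have hSL : S ∈ L := by
      refine (hL.1 S).1 ⟨hS, fun T hT hST => ?_⟩
      exact (hsub (hU T hT) (hU S hS)).1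
        (hG.2 ((hK _).2 ⟨T, hT, rfl⟩) (Finset.image_subset_image hST))
    obtain ⟨i, hi, rfl⟩ := List.getElem_of_mem hSL
    exact ⟨⟨i, hm ▸ hi⟩, rfl⟩
  · rintro ⟨i, rfl⟩
    have hS := (hL.1 (L[i.val]'(hm ▸ i.2))).2 (List.getElem_mem _)
    refine ⟨(hK _).2 ⟨_, hS.prop, rfl⟩, fun G hG hle => ?_⟩
    obtain ⟨T, hT, rfl⟩ := (hK G).1 hG
    exact Finset.image_subset_image
      (hS.2 hT ((hsub (hU _ hS.prop) (hU T hT)).1 hle))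
  · have hjL : j.val < L.length := hm ▸ j.2
    have hstep : ∀ i (hi : i < j.val), ∃ k, ∃ hk : k < j.val, ∃ x ∈ L[j.val],
        x ∉ L[i] ∧ L[j.val].erase x ⊆ L[k] := by
      intro i hi
      obtain ⟨F'', hF'', h3⟩ := hL.2.getElem j.val hjL L[i] (Or.inr ⟨i, hi, rfl⟩)
      rcases hF'' with hF'' | ⟨k, hk, rfl⟩
      · exact absurd hF'' (Set.notMem_empty _)
      · exact ⟨k, hk, h3⟩
    have hcard : ((L[j.val]'hjL).image f).card = (L[j.val]'hjL).card :=
      Finset.card_image_of_injOn (hf.mono (Finset.coe_subset.2 (hgU _ _)))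
    have hpos : 0 < (L[j.val]'hjL).card := by
      obtain ⟨_, _, x, hx, _⟩ := hstep 0 hj
      exact Finset.card_pos.2 ⟨x, hx⟩
    refine ⟨(L[j.val]'hjL).card - 1, by rw [hcard]; omega, fun G hG => ?_⟩
    obtain ⟨⟨hGj, i, hij, hGi⟩, hmax⟩ := hG
    obtain ⟨k, hk, x, hx, hxi, hsk⟩ := hstep i.val hij
    have hGe : G ⊆ ((L[j.val]'hjL).erase x).image f := by
      intro w hw
      obtain ⟨y, hy, rfl⟩ := Finset.mem_image.1 (hGj hw)
      obtain ⟨z, hz, hzy⟩ := Finset.mem_image.1 (hGi hw)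
      have hyz : z = y := hf (hgU _ _ hz) (hgU _ _ hy) hzy
      refine Finset.mem_image_of_mem f (Finset.mem_erase.2 ⟨?_, hy⟩)
      rintro rfl
      exact hxi (hyz ▸ hz)
    have hmem : ((L[j.val]'hjL).erase x).image f ⊆ G :=
      hmax ⟨Finset.image_subset_image (Finset.erase_subset _ _), ⟨k, hk.trans j.2⟩, hk,
        Finset.image_subset_image hsk⟩ hGe
    rw [hGe.antisymm hmem, Finset.card_image_of_injOn
      (hf.mono (Finset.coe_subset.2 ((Finset.erase_subset _ _).trans (hgU _ _)))),
      Finset.card_erase_of_mem hx]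

open Classical in
/-- The vertices in `W` outside the closed neighbourhood of `v`. -/
noncomputable def away (adj : V → V → Prop) (W : Finset V) (v : V) : Finset V :=
  {b ∈ W | b ≠ v ∧ ¬ adj v b}

section Independent

variable {adj : V → V → Prop} {W W' : Finset V} {q v : V}

theorem mem_away {b : V} : b ∈ away adj W v ↔ b ∈ W ∧ b ≠ v ∧ ¬ adj v b := by
  simp [away]

theorem insert_mem_independent (hs : ∀ a b, adj a b → adj b a) (hirr : ∀ a, ¬ adj a a) {S : Finset V}
    (hv : v ∈ W) (hS : S ∈ independent adj (away adj W v)) :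
    insert v S ∈ independent adj W := by
  refine ⟨Finset.insert_subset hv fun b hb => (mem_away.1 (hS.1 hb)).1, ?_⟩
  intro a ha b hb
  rcases Finset.mem_insert.1 ha with rfl | ha' <;> rcases Finset.mem_insert.1 hb with rfl | hb'
  · exact hirr _
  · exact (mem_away.1 (hS.1 hb')).2.2
  · exact fun h => (mem_away.1 (hS.1 ha')).2.2 (hs _ _ h)
  · exact hS.2 a ha' b hb'

theorem erase_mem_independent {S : Finset V} (hv : v ∈ S) (hS : S ∈ independent adj W) :
    S.erase v ∈ independent adj (away adj W v) := by
  refine ⟨fun b hb => ?_, fun a ha b hb =>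
    hS.2 a (Finset.mem_of_mem_erase ha) b (Finset.mem_of_mem_erase hb)⟩
  obtain ⟨h1, h2⟩ := Finset.mem_erase.1 hb
  exact mem_away.2 ⟨hS.1 h2, h1, hS.2 v hv b h2⟩

theorem isFacet_insert (hs : ∀ a b, adj a b → adj b a) (hirr : ∀ a, ¬ adj a a) {S : Finset V} (hv : v ∈ W)
    (hS : IsFacet (independent adj (away adj W v)) S) :
    IsFacet (independent adj W) (insert v S) := by
  refine ⟨insert_mem_independent hs hirr hv hS.prop, fun T hT hle => ?_⟩
  have hvT : v ∈ T := hle (Finset.mem_insert_self _ _)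
  have hvS : v ∉ S := fun h => (mem_away.1 (hS.prop.1 h)).2.1 rfl
  have h1 := hS.2 (erase_mem_independent hvT hT)
    (fun b hb => Finset.mem_erase.2 ⟨by rintro rfl; exact hvS hb,
      hle (Finset.mem_insert_of_mem hb)⟩)
  intro b hb
  by_cases hbv : b = v
  · exact hbv ▸ Finset.mem_insert_self _ _
  · exact Finset.mem_insert_of_mem (h1 (Finset.mem_erase.2 ⟨hbv, hb⟩))

theorem isFacet_erase (hs : ∀ a b, adj a b → adj b a) (hirr : ∀ a, ¬ adj a a) {S : Finset V} (hv : v ∈ S)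
    (hS : IsFacet (independent adj W) S) :
    IsFacet (independent adj (away adj W v)) (S.erase v) := by
  refine ⟨erase_mem_independent hv hS.prop, fun T hT hle => ?_⟩
  have h1 := hS.2 (insert_mem_independent hs hirr (hS.prop.1 hv) hT) (by
    intro b hb
    by_cases hbv : b = v
    · exact hbv ▸ Finset.mem_insert_self _ _
    · exact Finset.mem_insert_of_mem (hle (Finset.mem_erase.2 ⟨hbv, hb⟩)))
  intro b hb
  refine Finset.mem_erase.2 ⟨(mem_away.1 (hT.1 hb)).2.1, h1 (Finset.mem_insert_of_mem hb)⟩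

/-- `q` is a vertex in `W` whose closed neighbourhood in `W` is a clique. -/
def IsSimplicial (adj : V → V → Prop) (W : Finset V) (q : V) : Prop :=
  q ∈ W ∧ ∀ a ∈ W, ∀ b ∈ W, adj q a → adj q b → a ≠ b → adj a b

theorem isShellingList_of_isSimplicial (hs : ∀ a b, adj a b → adj b a) (hirr : ∀ a, ¬ adj a a)
    (hq : IsSimplicial adj W q) {vs : List V} (hnd : vs.Nodup)
    (hvs : ∀ v, v ∈ vs ↔ v ∈ W ∧ adj q v) {L : V → List (Finset V)}
    (hL₀ : IsShellingList (independent adj (away adj W q)) (L q))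
    (hL : ∀ v ∈ vs, IsShellingList (independent adj (away adj W v)) (L v)) :
    IsShellingList (independent adj W)
      ((L q).map (insert q) ++ vs.flatMap fun v => (L v).map (insert v)) := by
  have hnot : ∀ v, v = q ∨ v ∈ vs → ∀ F ∈ L v, ∀ w, w = v ∨ adj v w → w ∉ F := by
    intro v hv F hF w hw hwF
    have hF' : F ⊆ away adj W v := by
      rcases hv with rfl | hv
      · exact ((hL₀.1 F).2 hF).prop.1
      · exact (((hL v hv).1 F).2 hF).prop.1
    obtain ⟨_, h1, h2⟩ := mem_away.1 (hF' hwF)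
    tauto
  refine ⟨fun G => ?_, ?_⟩
  · simp only [List.mem_append, List.mem_map, List.mem_flatMap]
    constructor
    · intro hG
      by_cases hqG : q ∈ G
      · exact Or.inl ⟨G.erase q, (hL₀.1 _).1 (isFacet_erase hs hirr hqG hG),
          Finset.insert_erase hqG⟩
      obtain ⟨v, hvG, hqv⟩ : ∃ v ∈ G, adj q v := by
        by_contra! hno
        refine hqG (hG.2 (insert_mem_independent hs hirr hq.1 ⟨fun b hb => mem_away.2
          ⟨hG.prop.1 hb, ?_, hno b hb⟩, hG.prop.2⟩) (Finset.subset_insert _ _)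
          (Finset.mem_insert_self _ _))
        rintro rfl
        exact hqG hb
      have hv := (hvs v).2 ⟨hG.prop.1 hvG, hqv⟩
      exact Or.inr ⟨v, hv, G.erase v, ((hL v hv).1 _).1 (isFacet_erase hs hirr hvG hG),
        Finset.insert_erase hvG⟩
    · rintro (⟨F, hF, rfl⟩ | ⟨v, hv, F, hF, rfl⟩)
      · exact isFacet_insert hs hirr hq.1 ((hL₀.1 F).2 hF)
      · exact isFacet_insert hs hirr ((hvs v).1 hv).1 (((hL v hv).1 F).2 hF)
  · have h0 : Extends ∅ ((L q).map (insert q)) := by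
      have := hL₀.2.map_insert (A := ∅) (v := q) (fun F hF => hnot q (Or.inl rfl) F hF q
        (Or.inl rfl)) (by simp) (by simp)
      simpa using this
    rw [extends_append]
    refine ⟨h0, ?_⟩
    rw [Set.empty_union]
    -- The closed neighbourhood of `q` lies in that of `v`, so a set away from `v` is away from `q`.
    have hcover : ∀ v ∈ vs, ∀ F ∈ L v, ∃ F' ∈ (L q).map (insert q), F ⊆ F' := by
      intro v hv F hF
      have hvW := (hvs v).1 hv
      have hFI := (((hL v hv).1 F).2 hF).prop
      have hFq : F ∈ independent adj (away adj W q) := by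
        refine ⟨fun b hb => ?_, hFI.2⟩
        obtain ⟨h1, h2, h3⟩ := mem_away.1 (hFI.1 hb)
        refine mem_away.2 ⟨h1, ?_, fun h => h3 (hq.2 v hvW.1 b h1 hvW.2 h h2.symm)⟩
        rintro rfl
        exact h3 (hs _ _ hvW.2)
      obtain ⟨G, hFG, hG⟩ := exists_facet_of_independent hFq
      exact ⟨insert q G, List.mem_map_of_mem ((hL₀.1 G).1 hG),
        hFG.trans (Finset.subset_insert _ _)⟩
    -- `A` holds the facets listed so far: it includes the block of `q`, and none of its members
    -- contains a neighbour still to come.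
    have hmain : ∀ us : List V, us ⊆ vs → us.Nodup → ∀ A : Set (Finset V),
        (∀ F ∈ (L q).map (insert q), F ∈ A) → (∀ u ∈ us, ∀ F ∈ A, u ∉ F) →
        Extends A (us.flatMap fun v => (L v).map (insert v)) := by
      intro us
      induction us with
      | nil => exact fun _ _ _ _ _ => trivial
      | cons v us ih =>
        intro hsub hnd A hA hout
        have hv : v ∈ vs := hsub List.mem_cons_self
        obtain ⟨hvus, hnd⟩ := List.nodup_cons.1 hnd
        rw [List.flatMap_cons, extends_append]
        constructor
        · have := (hL v hv).2.map_insert (A := A) (v := v)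
            (fun F hF => hnot v (Or.inr hv) F hF v (Or.inl rfl)) (hout v List.mem_cons_self)
            (fun _ F hF => by
              obtain ⟨F', hF', h⟩ := hcover v hv F hF
              exact ⟨F', hA F' hF', h⟩)
          simpa using this
        · refine ih (fun u hu => hsub (List.mem_cons_of_mem _ hu)) hnd _
            (fun F hF => Or.inl (hA F hF)) ?_
          rintro u hu F (hF | hF)
          · exact hout u (List.mem_cons_of_mem _ hu) F hF
          · obtain ⟨G, hG, rfl⟩ := List.mem_map.1 hF
            have huv : u ≠ v := by rintro rfl; exact hvus hu
            have hu' := (hvs u).1 (hsub (List.mem_cons_of_mem _ hu))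
            have hv' := (hvs v).1 hv
            have := hnot v (Or.inr hv) G hG u
              (Or.inr (hq.2 v hv'.1 u hu'.1 hv'.2 hu'.2 huv.symm))
            simp [huv, this]
    refine hmain vs (List.Subset.refl _) hnd _ (fun F hF => hF) ?_
    intro u hu F hF
    obtain ⟨G, hG, rfl⟩ := List.mem_map.1 hF
    have hu' := (hvs u).1 hu
    have huq : u ≠ q := by rintro rfl; exact hirr _ hu'.2
    have := hnot q (Or.inl rfl) G hG u (Or.inr hu'.2)
    simp [huq, this]

variable (adj) in
/-- Vertex sets that can be exhausted by passing repeatedly from `W` to the vertices outside the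
closed neighbourhood of a vertex `v` in the closed neighbourhood of a simplicial vertex. -/
inductive Decomposable : Finset V → Prop
  | empty : Decomposable ∅
  | step {W : Finset V} {q : V} (hq : IsSimplicial adj W q) (hq₀ : Decomposable (away adj W q))
      (h : ∀ v ∈ W, adj q v → Decomposable (away adj W v)) : Decomposable W

theorem isShellingList_empty : IsShellingList (independent adj (∅ : Finset V)) [∅] := by
  refine ⟨fun G => ?_, by simp [Extends]⟩
  rw [List.mem_singleton]
  constructor
  · exact fun h => Finset.subset_empty.1 h.prop.1
  · rintro rfl
    exact ⟨⟨le_rfl, by simp⟩, fun T hT _ => hT.1⟩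

theorem Decomposable.exists_isShellingList (hs : ∀ a b, adj a b → adj b a) (hirr : ∀ a, ¬ adj a a)
    (h : Decomposable adj W) : ∃ L, IsShellingList (independent adj W) L := by
  induction h with
  | empty => exact ⟨_, isShellingList_empty⟩
  | @step W q hq hq₀ h ih₀ ih =>
    classical
    have : ∀ v, ∃ L, v = q ∨ (v ∈ W ∧ adj q v) →
        IsShellingList (independent adj (away adj W v)) L := by
      intro v
      by_cases hv : v = q
      · obtain ⟨L, hL⟩ := ih₀
        exact ⟨L, fun _ => hv ▸ hL⟩
      by_cases hv' : v ∈ W ∧ adj q v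
      · obtain ⟨L, hL⟩ := ih v hv'.1 hv'.2
        exact ⟨L, fun _ => hL⟩
      · exact ⟨[], by tauto⟩
    choose L hL using this
    exact ⟨_, isShellingList_of_isSimplicial hs hirr hq
      (vs := (W.filter (adj q)).toList) (Finset.nodup_toList _) (by simp) (hL q (Or.inl rfl))
      fun v hv => hL v (Or.inr (by simpa using hv))⟩

theorem away_union (W W' : Finset V) (v : V) :
    away adj (W ∪ W') v = away adj W v ∪ away adj W' v := by
  ext b
  simp only [mem_away, Finset.mem_union, or_and_right]

theorem away_eq_self (hv : v ∉ W) (h : ∀ b ∈ W, ¬ adj v b) : away adj W v = W := by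
  ext b
  rw [mem_away, and_iff_left_iff_imp]
  exact fun hb => ⟨by rintro rfl; exact hv hb, h b hb⟩

/-- The steps for `W` leave `W'` untouched; once `W` is exhausted, `W'` takes over. -/
theorem Decomposable.union (hW : Decomposable adj W) (hW' : Decomposable adj W')
    (hdis : ∀ a ∈ W, ∀ b ∈ W', a ≠ b ∧ ¬ adj a b) : Decomposable adj (W ∪ W') := by
  induction hW with
  | empty => rwa [Finset.empty_union]
  | @step W q hq hq₀ h ih₀ ih =>
    have haway : ∀ v ∈ W, away adj (W ∪ W') v = away adj W v ∪ W' := fun v hv => by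
      rw [away_union, away_eq_self (W := W') (fun h => (hdis v hv v h).1 rfl)
        fun b hb => (hdis v hv b hb).2]
    have hW : ∀ v ∈ W ∪ W', adj q v → v ∈ W := fun v hv hqv =>
      (Finset.mem_union.1 hv).resolve_right fun h => (hdis q hq.1 v h).2 hqv
    refine .step (q := q) ⟨Finset.mem_union_left _ hq.1, fun a ha b hb hqa hqb =>
      hq.2 a (hW a ha hqa) b (hW b hb hqb) hqa hqb⟩ ?_ fun v hv hqv => ?_
    · rw [haway q hq.1]
      exact ih₀ fun a ha => hdis a (mem_away.1 ha).1
    · rw [haway v (hW v hv hqv)]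
      exact ih v (hW v hv hqv) hqv fun a ha => hdis a (mem_away.1 ha).1

end Independent

end Shelling

/-! ### The graph of incompatible boxes -/

namespace AltTamari

open Shelling

variable {n : ℕ} {ν : Fin (n + 1) → ℕ} {δ : Fin n → ℕ}

open Classical in
/-- The boxes in the rows `R` and the columns `C`. -/
noncomputable def grid (ν : Fin (n + 1) → ℕ) (δ : Fin n → ℕ) (R : Finset ℕ) (C : Set ℕ) :
    Finset (ℕ × ℕ) := {b ∈ boxes ν δ | b.2 ∈ R ∧ b.1 ∈ C}

/-- `q` is the rightmost box in the lowest nonempty row of `W`. -/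
structure IsLowestRightmost (W : Finset (ℕ × ℕ)) (q : ℕ × ℕ) : Prop where
  mem : q ∈ W
  lowest : ∀ b ∈ W, q.2 ≤ b.2
  rightmost : ∀ b ∈ W, b.2 = q.2 → b.1 ≤ q.1

theorem exists_isLowestRightmost {W : Finset (ℕ × ℕ)} (hW : W.Nonempty) :
    ∃ q, IsLowestRightmost W q := by
  obtain ⟨p, hp, hmin⟩ := W.exists_min_image Prod.snd hW
  obtain ⟨q, hq, hmax⟩ := {b ∈ W | b.2 = p.2}.exists_max_image Prod.fst
    ⟨p, Finset.mem_filter.2 ⟨hp, rfl⟩⟩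
  obtain ⟨hqW, hqp⟩ := Finset.mem_filter.1 hq
  exact ⟨q, hqW, fun b hb => hqp ▸ hmin b hb, fun b hb h =>
    hmax b (Finset.mem_filter.2 ⟨hb, h.trans hqp⟩)⟩

theorem not_boxIncompatible_self (a : ℕ × ℕ) : ¬ BoxIncompatible ν δ a a := fun h => h.1 rfl

section Grid

variable {R : Finset ℕ} {C : Set ℕ} {q v : ℕ × ℕ}

theorem mem_grid (hδ : ∀ i, δ i ≤ ν i.succ) {b : ℕ × ℕ} : b ∈ grid ν δ R C ↔
    (b.2 < n ∧ left ν δ b.2 ≤ b.1 ∧ b.1 < right ν δ b.2) ∧ b.2 ∈ R ∧ b.1 ∈ C := by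
  simp only [grid, Finset.mem_filter, mem_boxes hδ]

open Classical in
theorem grid_subset : grid ν δ R C ⊆ boxes ν δ := Finset.filter_subset _ _

/-- If `b` were north-east of `q` with the rectangle in the shape, then `(b.1, q.2)` would be a box
of the grid to the right of `q`. -/
theorem boxIncompatible_lowestRightmost_iff (hδ : ∀ i, δ i ≤ ν i.succ)
    (hq : IsLowestRightmost (grid ν δ R C) q) {b : ℕ × ℕ} (hb : b ∈ grid ν δ R C) :
    BoxIncompatible ν δ q b ↔ q ≠ b ∧ (b.1 = q.1 ∨ b.2 = q.2) := by
  rw [boxIncompatible_iff hδ (grid_subset hq.mem) (grid_subset hb)]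
  refine and_congr_right fun hne => ⟨?_, by omega⟩
  have hlow := hq.lowest b hb
  have hq' := (mem_grid hδ).1 hq.mem
  have hb' := (mem_grid hδ).1 hb
  rintro (h | h | ⟨h1, h2, h3⟩ | ⟨h1, h2, h3⟩)
  · exact Or.inl h.symm
  · exact Or.inr h.symm
  · have := hq.rightmost (b.1, q.2) ((mem_grid hδ).2
      ⟨⟨hq'.1.1, by dsimp only; omega, h3⟩, hq'.2.1, hb'.2.2⟩) rfl
    dsimp only at this
    omega
  · omega

/-- The rectangle spanned by a neighbour in the row and one in the column has `q` as its south-east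
corner, so it lies in the shape. -/
theorem isSimplicial_lowestRightmost (hδ : ∀ i, δ i ≤ ν i.succ)
    (hq : IsLowestRightmost (grid ν δ R C) q) :
    IsSimplicial (BoxIncompatible ν δ) (grid ν δ R C) q := by
  refine ⟨hq.mem, ?_⟩
  have hq' := (mem_grid hδ).1 hq.mem
  have key : ∀ a ∈ grid ν δ R C, ∀ b ∈ grid ν δ R C, a.2 = q.2 → b.1 = q.1 → a ≠ b →
      BoxIncompatible ν δ a b := by
    intro a ha b hb h1 h2 hne
    rw [boxIncompatible_iff hδ (grid_subset ha) (grid_subset hb)]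
    have e1 := hq.rightmost a ha h1
    have e2 := hq.lowest b hb
    rw [← h1] at hq'
    exact ⟨hne, by omega⟩
  intro a ha b hb hqa hqb hne
  rw [boxIncompatible_lowestRightmost_iff hδ hq ha] at hqa
  rw [boxIncompatible_lowestRightmost_iff hδ hq hb] at hqb
  rcases hqa with ⟨-, h1 | h1⟩ <;> rcases hqb with ⟨-, h2 | h2⟩
  · exact ⟨hne, Or.inl (h1.trans h2.symm)⟩
  · exact (key b hb a ha h2 h1 hne.symm).symm
  · exact key a ha b hb h1 h2 hne
  · exact ⟨hne, Or.inr (Or.inl (h1.trans h2.symm))⟩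

/-- The columns from `v.1` to `q.1` are lost because the row of `v` extends to `q`. Boxes further
east survive: by the choice of `q` they lie past the end of its row. -/
theorem away_row (hδ : ∀ i, δ i ≤ ν i.succ) (hq : IsLowestRightmost (grid ν δ R C) q)
    (hv : v ∈ grid ν δ R C) (hvq : v.2 = q.2) :
    away (BoxIncompatible ν δ) (grid ν δ R C) v =
      grid ν δ (R.erase q.2) {x | x ∈ C ∧ (x < v.1 ∨ q.1 < x)} := by
  ext b
  rw [mem_away]
  have hq' := (mem_grid hδ).1 hq.mem
  have hv' := (mem_grid hδ).1 hv
  rw [hvq] at hv'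
  constructor
  · rintro ⟨hb, hne, hc⟩
    have hb' := (mem_grid hδ).1 hb
    have hlow := hq.lowest b hb
    rw [boxIncompatible_iff hδ (grid_subset hv) (grid_subset hb), hvq] at hc
    rw [mem_grid hδ, Finset.mem_erase]
    have hrow : b.2 ≠ q.2 := fun h => hc ⟨hne.symm, by omega⟩
    refine ⟨hb'.1, ⟨hrow, hb'.2.1⟩, hb'.2.2, ?_⟩
    by_contra hcol
    exact hc ⟨hne.symm, by omega⟩
  · intro hb
    rw [mem_grid hδ, Finset.mem_erase] at hb
    obtain ⟨hbox, ⟨hrow, hR⟩, hC, hcol⟩ := hb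
    have hb : b ∈ grid ν δ R C := (mem_grid hδ).2 ⟨hbox, hR, hC⟩
    have hlow := hq.lowest b hb
    have hvr := hq.rightmost v hv hvq
    refine ⟨hb, fun h => hrow (h ▸ hvq), ?_⟩
    rw [boxIncompatible_iff hδ (grid_subset hv) (grid_subset hb), hvq]
    rintro ⟨-, h | h | ⟨h1, h2, h3⟩ | ⟨h1, h2, h3⟩⟩
    · omega
    · omega
    · have := hq.rightmost (b.1, q.2) ((mem_grid hδ).2
        ⟨⟨hq'.1.1, by dsimp only; omega, h3⟩, hq'.2.1, hC⟩) rfl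
      dsimp only at this
      omega
    · omega

/-- Every box south-west of `v` is lost, since its row extends to column `q.1`; north-east of `v`
only boxes past the end of its row survive. -/
theorem away_column (hδ : ∀ i, δ i ≤ ν i.succ) (hq : IsLowestRightmost (grid ν δ R C) q)
    (hv : v ∈ grid ν δ R C) (hvq : v.1 = q.1) :
    away (BoxIncompatible ν δ) (grid ν δ R C) v =
      grid ν δ {y ∈ R | y < v.2} {x | x ∈ C ∧ q.1 < x} ∪
      grid ν δ {y ∈ R | v.2 < y} {x | x ∈ C ∧ (x < q.1 ∨ right ν δ v.2 ≤ x)} := by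
  ext b
  rw [mem_away, Finset.mem_union, mem_grid hδ (R := {y ∈ R | y < v.2}),
    mem_grid hδ (R := {y ∈ R | v.2 < y})]
  simp only [Finset.mem_filter, Set.mem_ofPred_eq]
  have hq' := (mem_grid hδ).1 hq.mem
  have hv' := (mem_grid hδ).1 hv
  constructor
  · rintro ⟨hb, hne, hc⟩
    have hb' := (mem_grid hδ).1 hb
    have hlow := hq.lowest b hb
    have hr := right_mono (ν := ν) (δ := δ) hlow
    rw [boxIncompatible_iff hδ (grid_subset hv) (grid_subset hb), hvq] at hc
    have hc' : ¬ (q.1 = b.1 ∨ v.2 = b.2 ∨ (q.1 < b.1 ∧ v.2 < b.2 ∧ b.1 < right ν δ v.2) ∨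
      (b.1 < q.1 ∧ b.2 < v.2 ∧ q.1 < right ν δ b.2)) := fun h => hc ⟨hne.symm, h⟩
    rcases lt_trichotomy b.2 v.2 with h | h | h
    · exact Or.inl ⟨hb'.1, ⟨hb'.2.1, h⟩, hb'.2.2, by omega⟩
    · omega
    · exact Or.inr ⟨hb'.1, ⟨hb'.2.1, h⟩, hb'.2.2, by omega⟩
  · rintro (⟨hbox, ⟨hR, hrow⟩, hC, hcol⟩ | ⟨hbox, ⟨hR, hrow⟩, hC, hcol⟩) <;>
    · have hb : b ∈ grid ν δ R C := (mem_grid hδ).2 ⟨hbox, hR, hC⟩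
      refine ⟨hb, fun h => (by rw [h] at hrow; exact lt_irrefl _ hrow), ?_⟩
      rw [boxIncompatible_iff hδ (grid_subset hv) (grid_subset hb), hvq]
      omega

theorem exists_away_eq (hδ : ∀ i, δ i ≤ ν i.succ) (hq : IsLowestRightmost (grid ν δ R C) q)
    (hv : v ∈ grid ν δ R C) (hvq : v = q ∨ BoxIncompatible ν δ q v) :
    ∃ R₁ C₁ R₂ C₂, R₁ ⊂ R ∧ R₂ ⊂ R ∧
      away (BoxIncompatible ν δ) (grid ν δ R C) v = grid ν δ R₁ C₁ ∪ grid ν δ R₂ C₂ ∧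
      ∀ a ∈ grid ν δ R₁ C₁, ∀ b ∈ grid ν δ R₂ C₂, a ≠ b ∧ ¬ BoxIncompatible ν δ a b := by
  have hq' := (mem_grid hδ).1 hq.mem
  have hv' := (mem_grid hδ).1 hv
  have hcases : v.2 = q.2 ∨ v.1 = q.1 := by
    rcases hvq with rfl | h
    · exact Or.inl rfl
    · exact ((boxIncompatible_lowestRightmost_iff hδ hq hv).1 h).2.symm
  rcases hcases with h | h
  · refine ⟨_, {x | x ∈ C ∧ (x < v.1 ∨ q.1 < x)}, ∅, ∅, Finset.erase_ssubset hq'.2.1, ?_, ?_, ?_⟩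
    · exact Finset.empty_ssubset.2 ⟨_, hq'.2.1⟩
    · rw [away_row hδ hq hv h]
      ext b
      rw [Finset.mem_union, mem_grid hδ (R := ∅)]
      simp
    · intro a _ b hb
      rw [mem_grid hδ] at hb
      simp at hb
  · refine ⟨_, _, _, _, ?_, ?_, away_column hδ hq hv h, ?_⟩
    · exact Finset.filter_ssubset.2 ⟨v.2, hv'.2.1, lt_irrefl _⟩
    · exact Finset.filter_ssubset.2 ⟨v.2, hv'.2.1, lt_irrefl _⟩
    · intro a ha b hb
      rw [boxIncompatible_iff hδ (grid_subset ha) (grid_subset hb)]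
      rw [mem_grid hδ] at ha hb
      simp only [Finset.mem_filter, Set.mem_ofPred_eq] at ha hb
      obtain ⟨ha1, ⟨-, ha2⟩, -, ha3⟩ := ha
      obtain ⟨hb1, ⟨-, hb2⟩, -, hb3⟩ := hb
      -- The row of a lower box ends no later than that of `v`, so an upper box is either west of it
      -- or past the end of its row.
      have hr := right_mono (ν := ν) (δ := δ) ha2.le
      refine ⟨by rintro rfl; omega, by omega⟩

theorem decomposable_grid (hδ : ∀ i, δ i ≤ ν i.succ) (R : Finset ℕ) (C : Set ℕ) :
    Decomposable (BoxIncompatible ν δ) (grid ν δ R C) := by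
  induction R using Finset.strongInduction generalizing C with
  | H R ih =>
    rcases (grid ν δ R C).eq_empty_or_nonempty with h | h
    · exact h ▸ .empty
    obtain ⟨q, hq⟩ := exists_isLowestRightmost h
    have key : ∀ v ∈ grid ν δ R C, v = q ∨ BoxIncompatible ν δ q v →
        Decomposable (BoxIncompatible ν δ) (away (BoxIncompatible ν δ) (grid ν δ R C) v) := by
      intro v hv hvq
      obtain ⟨R₁, C₁, R₂, C₂, h1, h2, h3, h4⟩ := exists_away_eq hδ hq hv hvq
      rw [h3]
      exact (ih R₁ h1 C₁).union (ih R₂ h2 C₂) h4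
    exact .step (isSimplicial_lowestRightmost hδ hq) (key q hq.mem (Or.inl rfl))
      fun v hv hqv => key v hv (Or.inr hqv)

theorem exists_isShellingList_away (hδ : ∀ i, δ i ≤ ν i.succ)
    (hq : IsLowestRightmost (grid ν δ R C) q) (hv : v ∈ grid ν δ R C)
    (hqv : BoxIncompatible ν δ q v) :
    ∃ L, IsShellingList (independent (BoxIncompatible ν δ)
      (away (BoxIncompatible ν δ) (grid ν δ R C) v)) L := by
  obtain ⟨R₁, C₁, R₂, C₂, -, -, h3, h4⟩ := exists_away_eq hδ hq hv (Or.inr hqv)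
  rw [h3]
  exact ((decomposable_grid hδ R₁ C₁).union (decomposable_grid hδ R₂ C₂)
    h4).exists_isShellingList (fun _ _ => BoxIncompatible.symm) not_boxIncompatible_self

end Grid

/-! ### The greedy boxes -/

theorem greedyBelow_succ_cases (ν : Fin (n + 1) → ℕ) (δ : Fin n → ℕ) (y : ℕ) :
    ((∀ b ∈ boxes ν δ, b.2 = y → ¬ ∀ a ∈ greedyBelow ν δ y, ¬ BoxIncompatible ν δ a b) ∧
      greedyBelow ν δ (y + 1) = greedyBelow ν δ y) ∨
    ∃ q ∈ boxes ν δ, q.2 = y ∧ (∀ a ∈ greedyBelow ν δ y, ¬ BoxIncompatible ν δ a q) ∧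
      (∀ b ∈ boxes ν δ, b.2 = y → (∀ a ∈ greedyBelow ν δ y, ¬ BoxIncompatible ν δ a b) →
        b.1 ≤ q.1) ∧ greedyBelow ν δ (y + 1) = greedyBelow ν δ y ++ [q] := by
  rw [greedyBelow]
  generalize hc : {b ∈ boxes ν δ | b.2 = y ∧
    ∀ a ∈ greedyBelow ν δ y, ¬ BoxIncompatible ν δ a b} = c
  have hmem : ∀ b, b ∈ c ↔ b ∈ boxes ν δ ∧ b.2 = y ∧
      ∀ a ∈ greedyBelow ν δ y, ¬ BoxIncompatible ν δ a b := by
    intro b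
    rw [← hc, Finset.mem_filter]
  split_ifs with h
  · refine Or.inl ⟨fun b hb hby hab => ?_, rfl⟩
    have := (hmem b).2 ⟨hb, hby, hab⟩
    rw [h] at this
    exact Finset.notMem_empty _ this
  · right
    obtain ⟨q, hq, hsup⟩ := Finset.exists_mem_eq_sup c (Finset.nonempty_iff_ne_empty.2 h) Prod.fst
    have hq' := (hmem q).1 hq
    refine ⟨q, hq'.1, hq'.2.1, hq'.2.2, fun b hb hby hab => ?_, ?_⟩
    · rw [← hsup]
      exact Finset.le_sup (f := Prod.fst) ((hmem b).2 ⟨hb, hby, hab⟩)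
    · rw [hsup, ← hq'.2.1]

theorem mem_greedyBelow {y : ℕ} {a : ℕ × ℕ} (ha : a ∈ greedyBelow ν δ y) : a.2 < y := by
  induction y with
  | zero => simp [greedyBelow] at ha
  | succ y ih =>
    rcases greedyBelow_succ_cases ν δ y with ⟨-, h⟩ | ⟨q, -, hq, -, -, h⟩
    · rw [h] at ha
      exact (ih ha).trans (Nat.lt_succ_self _)
    · rw [h, List.mem_append, List.mem_singleton] at ha
      rcases ha with ha | rfl
      · exact (ih ha).trans (Nat.lt_succ_self _)
      · omega

theorem greedyBelow_prefix {y z : ℕ} (h : y ≤ z) : greedyBelow ν δ y <+: greedyBelow ν δ z := by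
  induction z, h using Nat.le_induction with
  | base => exact List.prefix_rfl
  | succ z _ ih =>
    rcases greedyBelow_succ_cases ν δ z with ⟨-, h⟩ | ⟨q, -, -, -, -, h⟩
    · rwa [h]
    · rw [h]
      exact ih.trans (List.prefix_append _ _)

theorem mem_greedyBelow_of_lt {y z : ℕ} {a : ℕ × ℕ} (hyz : y ≤ z)
    (ha : a ∈ greedyBelow ν δ z) (hay : a.2 < y) : a ∈ greedyBelow ν δ y := by
  induction z, hyz using Nat.le_induction with
  | base => exact ha
  | succ z hz ih =>
    rcases greedyBelow_succ_cases ν δ z with ⟨-, h⟩ | ⟨q, -, hq, -, -, h⟩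
    · exact ih (h ▸ ha)
    · rw [h, List.mem_append, List.mem_singleton] at ha
      rcases ha with ha | rfl
      · exact ih ha
      · omega

/-- A box north-east of a greedy `q` with the rectangle in the shape would give a candidate in the
row of `q` further right. Hence the boxes still available form a grid. -/
theorem compatible_greedyBelow_iff (hδ : ∀ i, δ i ≤ ν i.succ) {y : ℕ} {b : ℕ × ℕ}
    (hb : b ∈ boxes ν δ) (hby : y ≤ b.2) :
    (∀ a ∈ greedyBelow ν δ y, ¬ BoxIncompatible ν δ a b) ↔
      ∀ a ∈ greedyBelow ν δ y, a.1 ≠ b.1 := by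
  induction y generalizing b with
  | zero => simp [greedyBelow]
  | succ y ih =>
    rcases greedyBelow_succ_cases ν δ y with ⟨-, h⟩ | ⟨q, hq, hqy, -, hmax, h⟩
    · rw [h]
      exact ih hb (by omega)
    · simp only [h, List.mem_append, List.mem_singleton, or_imp, forall_and, forall_eq]
      rw [ih hb (by omega)]
      refine and_congr_right fun hcol => ?_
      have hq' := (mem_boxes hδ).1 hq
      rw [boxIncompatible_iff hδ hq hb]
      refine ⟨fun hc h1 => hc ⟨by rintro rfl; omega, Or.inl h1⟩, fun hne => ?_⟩
      rintro ⟨-, h1 | h1 | ⟨h1, h2, h3⟩ | ⟨h1, h2, h3⟩⟩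
      · exact hne h1
      · omega
      · have hbox : (b.1, y) ∈ boxes ν δ := by
          rw [mem_boxes hδ]
          rw [hqy] at hq' h3
          dsimp only
          omega
        have := hmax _ hbox rfl ((ih hbox le_rfl).2 hcol)
        dsimp only at this
        omega
      · omega

/-- The boxes in the rows from `y` on that are compatible with the greedy boxes below. -/
noncomputable def remaining (ν : Fin (n + 1) → ℕ) (δ : Fin n → ℕ) (y : ℕ) : Finset (ℕ × ℕ) :=
  grid ν δ (Finset.Ico y n) {x | ∀ a ∈ greedyBelow ν δ y, a.1 ≠ x}

theorem mem_remaining (hδ : ∀ i, δ i ≤ ν i.succ) {y : ℕ} {b : ℕ × ℕ} : b ∈ remaining ν δ y ↔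
    b ∈ boxes ν δ ∧ y ≤ b.2 ∧ ∀ a ∈ greedyBelow ν δ y, a.1 ≠ b.1 := by
  rw [remaining, mem_grid hδ, mem_boxes hδ, Finset.mem_Ico, Set.mem_ofPred_eq]
  tauto

theorem remaining_cases (hδ : ∀ i, δ i ≤ ν i.succ) (y : ℕ) :
    (greedyBelow ν δ (y + 1) = greedyBelow ν δ y ∧ remaining ν δ (y + 1) = remaining ν δ y) ∨
    ∃ q, q.2 = y ∧ IsLowestRightmost (remaining ν δ y) q ∧
      greedyBelow ν δ (y + 1) = greedyBelow ν δ y ++ [q] ∧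
      remaining ν δ (y + 1) = away (BoxIncompatible ν δ) (remaining ν δ y) q := by
  rcases greedyBelow_succ_cases ν δ y with ⟨hno, h⟩ | ⟨q, hq, hqy, hc, hmax, h⟩
  · refine Or.inl ⟨h, ?_⟩
    ext b
    rw [mem_remaining hδ, mem_remaining hδ, h]
    refine and_congr_right fun hb => ⟨fun ⟨h1, h2⟩ => ⟨by omega, h2⟩, fun ⟨h1, h2⟩ => ⟨?_, h2⟩⟩
    rcases h1.eq_or_lt with h1 | h1
    · exact absurd ((compatible_greedyBelow_iff hδ hb h1.le).2 h2) (hno b hb h1.symm)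
    · exact h1
  · have hlow : IsLowestRightmost (remaining ν δ y) q := by
      refine ⟨(mem_remaining hδ).2 ⟨hq, hqy.ge, (compatible_greedyBelow_iff hδ hq hqy.ge).1 hc⟩,
        fun b hb => hqy ▸ ((mem_remaining hδ).1 hb).2.1, fun b hb hbq => ?_⟩
      obtain ⟨h1, h2, h3⟩ := (mem_remaining hδ).1 hb
      exact hmax b h1 (hbq.trans hqy) ((compatible_greedyBelow_iff hδ h1 h2).2 h3)
    refine Or.inr ⟨q, hqy, hlow, h, ?_⟩
    ext b
    rw [mem_away]
    constructor
    · intro hb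
      rw [mem_remaining hδ, h] at hb
      simp only [List.mem_append, List.mem_singleton, or_imp, forall_and, forall_eq] at hb
      obtain ⟨h1, h2, h3, h4⟩ := hb
      have hb : b ∈ remaining ν δ y := (mem_remaining hδ).2 ⟨h1, by omega, h3⟩
      refine ⟨hb, by rintro rfl; omega, fun hqb => ?_⟩
      have := ((boxIncompatible_lowestRightmost_iff hδ hlow hb).1 hqb).2
      omega
    · rintro ⟨hb, hne, hqb⟩
      obtain ⟨h1, h2, h3⟩ := (mem_remaining hδ).1 hb
      rw [boxIncompatible_lowestRightmost_iff hδ hlow hb] at hqb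
      have hqb' : ¬ (b.1 = q.1 ∨ b.2 = q.2) := fun h => hqb ⟨hne.symm, h⟩
      rw [mem_remaining hδ, h]
      simp only [List.mem_append, List.mem_singleton, or_imp, forall_and, forall_eq]
      exact ⟨h1, by omega, h3, by omega⟩

theorem label_le_iff {y : ℕ} (hy : y ≤ n) {b : ℕ × ℕ} :
    label ν δ b ≤ (greedyBelow ν δ y).length ↔
      ∃ a ∈ greedyBelow ν δ y, a.1 = b.1 ∨ a.2 = b.2 := by
  obtain ⟨t, ht⟩ := greedyBelow_prefix (ν := ν) (δ := δ) hy
  have hlt := List.findIdx_lt_length (xs := greedyBelow ν δ y)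
    (p := fun q => decide (q.1 = b.1 ∨ q.2 = b.2))
  simp only [decide_eq_true_eq] at hlt
  rw [label, greedy, ← ht, List.findIdx_append, ← hlt]
  split_ifs <;> omega

/-- The greedy boxes below row `y` form an initial segment of the greedy list, and a remaining box
shares no row or column with any of them. -/
theorem label_lt_label (hδ : ∀ i, δ i ≤ ν i.succ) {y : ℕ} (hy : y ≤ n) {q v w : ℕ × ℕ}
    (hq : q ∈ greedyBelow ν δ y) (hqv : q.1 = v.1 ∨ q.2 = v.2) (hw : w ∈ remaining ν δ y) :
    label ν δ v < label ν δ w := by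
  refine ((label_le_iff hy).2 ⟨q, hq, hqv⟩).trans_lt (not_le.1 fun h => ?_)
  obtain ⟨a, ha, h1⟩ := (label_le_iff hy).1 h
  obtain ⟨-, h2, h3⟩ := (mem_remaining hδ).1 hw
  have := mem_greedyBelow ha
  have := h3 a ha
  omega

/-! ### The shelling -/

/-- Every box of `F` that is not greedy is followed by such a box of `F'`. -/
def LastPrecedes (ν : Fin (n + 1) → ℕ) (δ : Fin n → ℕ) (pos : ℕ × ℕ → ℕ)
    (F F' : Finset (ℕ × ℕ)) : Prop :=
  ∀ b ∈ F, b ∉ greedy ν δ → ∃ b' ∈ F', b' ∉ greedy ν δ ∧ pos b ≤ pos b'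

theorem exists_sorted_list {V : Type*} (S : Finset V) (pos : V → ℕ) :
    ∃ l : List V, l.Nodup ∧ (∀ v, v ∈ l ↔ v ∈ S) ∧ l.Pairwise fun a b => pos a ≤ pos b := by
  classical
  refine ⟨S.toList.insertionSort (pos ⁻¹'o (· ≤ ·)), ?_, ?_, ?_⟩
  · exact (List.perm_insertionSort _ _).nodup_iff.2 S.nodup_toList
  · intro v
    rw [(List.perm_insertionSort _ _).mem_iff, Finset.mem_toList]
  · exact List.pairwise_insertionSort _ _

-- Induction from the top row down. The block of the greedy box `q` in row `y` comes from the list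
-- for `y + 1`; the blocks of its neighbours follow, sorted by `pos`. All boxes of `remaining ν δ (y
-- + 1)` precede these neighbours.
open Classical in
theorem exists_shelling_remaining (hδ : ∀ i, δ i ≤ ν i.succ) {pos : ℕ × ℕ → ℕ}
    (hpos : ∀ b ∈ boxes ν δ, ∀ b' ∈ boxes ν δ, label ν δ b' < label ν δ b → pos b < pos b')
    {y k : ℕ} (hyk : y + k = n) :
    ∃ L, IsShellingList (independent (BoxIncompatible ν δ) (remaining ν δ y))
        ({b ∈ (greedy ν δ).toFinset | y ≤ b.2} :: L) ∧
      ({b ∈ (greedy ν δ).toFinset | y ≤ b.2} :: L).Pairwise (LastPrecedes ν δ pos) := by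
  induction k generalizing y with
  | zero =>
    obtain rfl : y = n := hyk
    have h1 : {b ∈ (greedy ν δ).toFinset | y ≤ b.2} = ∅ :=
      Finset.filter_eq_empty_iff.2 fun b hb => not_le.2 (mem_greedyBelow (List.mem_toFinset.1 hb))
    have h2 : remaining ν δ y = ∅ := by
      refine Finset.eq_empty_of_forall_notMem fun b hb => ?_
      obtain ⟨hb, hle, -⟩ := (mem_remaining hδ).1 hb
      have := ((mem_boxes hδ).1 hb).1
      omega
    refine ⟨[], ?_, List.pairwise_singleton _ _⟩
    rw [h1, h2]
    exact isShellingList_empty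
  | succ k ih =>
    obtain ⟨L₀, hL₀, hord⟩ := ih (y := y + 1) (by omega)
    rcases remaining_cases hδ y with ⟨hg, hr⟩ | ⟨q, hqy, hq, hg, hr⟩
    · have : {b ∈ (greedy ν δ).toFinset | y ≤ b.2} =
          {b ∈ (greedy ν δ).toFinset | y + 1 ≤ b.2} := by
        refine Finset.filter_congr fun b hb => ⟨fun h => ?_, by omega⟩
        by_contra hlt
        have := mem_greedyBelow_of_lt (y := y + 1) (by omega) (List.mem_toFinset.1 hb) (by omega)
        rw [hg] at this
        have := mem_greedyBelow this
        omega
      rw [this, ← hr]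
      exact ⟨L₀, hL₀, hord⟩
    have hqg' : q ∈ greedyBelow ν δ (y + 1) := by simp [hg]
    have hqg : q ∈ greedy ν δ := (greedyBelow_prefix (by omega)).subset hqg'
    have hhead : {b ∈ (greedy ν δ).toFinset | y ≤ b.2} =
        insert q {b ∈ (greedy ν δ).toFinset | y + 1 ≤ b.2} := by
      ext b
      simp only [Finset.mem_filter, List.mem_toFinset, Finset.mem_insert]
      constructor
      · rintro ⟨h1, h2⟩
        rcases h2.lt_or_eq with h2 | h2
        · exact Or.inr ⟨h1, h2⟩
        · have := mem_greedyBelow_of_lt (y := y + 1) (by omega) h1 (by omega)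
          rw [hg, List.mem_append, List.mem_singleton] at this
          rcases this with h | h
          · have := mem_greedyBelow h
            omega
          · exact Or.inl h
      · rintro (rfl | ⟨h1, h2⟩)
        · exact ⟨hqg, hqy.ge⟩
        · exact ⟨h1, by omega⟩
    have hsimp := isSimplicial_lowestRightmost hδ hq
    obtain ⟨vs, hnd, hvs, hsort⟩ := exists_sorted_list
      {v ∈ remaining ν δ y | BoxIncompatible ν δ q v} pos
    simp only [Finset.mem_filter] at hvs
    have hex : ∀ v, ∃ L, BoxIncompatible ν δ q v → v ∈ remaining ν δ y →
        IsShellingList (independent (BoxIncompatible ν δ)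
          (away (BoxIncompatible ν δ) (remaining ν δ y) v)) L := by
      intro v
      by_cases hv : BoxIncompatible ν δ q v ∧ v ∈ remaining ν δ y
      · obtain ⟨L, hL⟩ := exists_isShellingList_away hδ hq hv.2 hv.1
        exact ⟨L, fun _ _ => hL⟩
      · exact ⟨[], fun h1 h2 => absurd ⟨h1, h2⟩ hv⟩
    choose L hL using hex
    set H := {b ∈ (greedy ν δ).toFinset | y + 1 ≤ b.2} with hH
    have hneq : ∀ v ∈ vs, v ≠ q := fun v hv h =>
      not_boxIncompatible_self _ (h ▸ ((hvs v).1 hv).2)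
    have hlater : ∀ v ∈ vs, ∀ b ∈ remaining ν δ (y + 1), pos b < pos v := by
      intro v hv b hb
      have hv' := (hvs v).1 hv
      refine hpos b ((mem_remaining hδ).1 hb).1 v ((mem_remaining hδ).1 hv'.1).1
        (label_lt_label hδ (by omega) hqg' ?_ hb)
      have := ((boxIncompatible_lowestRightmost_iff hδ hq hv'.1).1 hv'.2).2
      omega
    have hnongreedy : ∀ v ∈ vs, v ∉ greedy ν δ := by
      intro v hv hvg
      have hv' := (hvs v).1 hv
      have h1 := ((mem_remaining hδ).1 hv'.1).2.1
      have h2 : v ∈ insert q H := hhead ▸ Finset.mem_filter.2 ⟨List.mem_toFinset.2 hvg, h1⟩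
      have h3 := ((hL₀.1 H).2 List.mem_cons_self).prop.1
        ((Finset.mem_insert.1 h2).resolve_left (hneq v hv))
      rw [hr] at h3
      exact (mem_away.1 h3).2.2 hv'.2
    have hlast : ∀ v ∈ vs, ∀ F ∈ L v, ∀ b ∈ insert v F, pos b ≤ pos v := by
      intro v hv F hF b hb
      rcases Finset.mem_insert.1 hb with rfl | hb
      · exact le_rfl
      have hv' := (hvs v).1 hv
      obtain ⟨h1, h2, h3⟩ := mem_away.1 ((((hL v hv'.2 hv'.1).1 F).2 hF).prop.1 hb)
      refine (hlater v hv b ?_).le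
      rw [hr, mem_away]
      refine ⟨h1, ?_, fun h => h3 (hsimp.2 v hv'.1 b h1 hv'.2 h h2.symm)⟩
      rintro rfl
      exact h3 hv'.2.symm
    -- The block of `q` must use the inductive list; the lists for the neighbours are arbitrary.
    obtain ⟨L', hL'q, hL'⟩ : ∃ L' : ℕ × ℕ → List (Finset (ℕ × ℕ)),
        L' q = H :: L₀ ∧ ∀ v ∈ vs, L' v = L v :=
      ⟨Function.update L q (H :: L₀), Function.update_self .., fun v hv =>
        Function.update_of_ne (hneq v hv) ..⟩
    have hshell := isShellingList_of_isSimplicial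
      (adj := BoxIncompatible ν δ) (W := remaining ν δ y) (fun _ _ => BoxIncompatible.symm)
      not_boxIncompatible_self hsimp hnd hvs (L := L') (by rw [hL'q, ← hr]; exact hL₀)
      (fun v hv => by
        rw [hL' v hv]
        exact hL v ((hvs v).1 hv).2 ((hvs v).1 hv).1)
    have hord' : ((L' q).map (insert q) ++ vs.flatMap fun v => (L' v).map (insert v)).Pairwise
        (LastPrecedes ν δ pos) := by
      rw [List.pairwise_append]
      refine ⟨?_, ?_, ?_⟩
      · rw [hL'q, List.pairwise_map]
        refine hord.imp fun {F F'} h b hb hbg => ?_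
        rcases Finset.mem_insert.1 hb with rfl | hb
        · exact absurd hqg hbg
        · obtain ⟨b', h1, h2⟩ := h b hb hbg
          exact ⟨b', Finset.mem_insert_of_mem h1, h2⟩
      · rw [List.pairwise_flatMap]
        have hstep : ∀ v ∈ vs, ∀ w ∈ vs, pos v ≤ pos w → ∀ F ∈ (L' v).map (insert v),
            ∀ F' ∈ (L' w).map (insert w), LastPrecedes ν δ pos F F' := by
          intro v hv w hw hvw F hF F' hF' b hb _
          rw [hL' v hv] at hF
          obtain ⟨G, hG, rfl⟩ := List.mem_map.1 hF
          obtain ⟨G', hG', rfl⟩ := List.mem_map.1 hF'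
          exact ⟨w, Finset.mem_insert_self _ _, hnongreedy w hw, (hlast v hv G hG b hb).trans hvw⟩
        refine ⟨fun v hv => List.pairwise_of_forall_mem_list fun F hF F' hF' =>
          hstep v hv v hv le_rfl F hF F' hF', ?_⟩
        exact hsort.imp_of_mem fun {v w} hv hw hvw => hstep v hv w hw hvw
      · intro F hF F' hF' b hb hbg
        rw [hL'q] at hF
        obtain ⟨G, hG, rfl⟩ := List.mem_map.1 hF
        obtain ⟨v, hv, hF'⟩ := List.mem_flatMap.1 hF'
        obtain ⟨G', hG', rfl⟩ := List.mem_map.1 hF'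
        rcases Finset.mem_insert.1 hb with rfl | hb
        · exact absurd hqg hbg
        · exact ⟨v, Finset.mem_insert_self _ _, hnongreedy v hv,
            (hlater v hv b (((hL₀.1 G).2 hG).prop.1 hb)).le⟩
    rw [hhead]
    rw [hL'q, List.map_cons, List.cons_append] at hshell hord'
    exact ⟨_, hshell, hord'⟩

end AltTamari

/-! ### Transfer from boxes to trees and conclusion. -/

theorem isSimplicialComplex_canonicalJoinComplex {n : ℕ} {ν : Fin (n + 1) → ℕ} {δ : Fin n → ℕ}
    (hδ : ∀ i, δ i ≤ ν i.succ) : Shelling.IsSimplicialComplex (canonicalJoinComplex ν δ) := by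
  classical
  refine ⟨⟨∅, (mem_canonicalJoinComplex_iff (hδ := hδ)).2 ⟨∅, by simp, by simp⟩⟩, ?_⟩
  intro A B hBA hA
  obtain ⟨S, ⟨hS, hc⟩, rfl⟩ := (mem_canonicalJoinComplex_iff (hδ := hδ)).1 hA
  obtain ⟨S', hS', rfl⟩ := Finset.subset_image_iff.1 hBA
  exact (mem_canonicalJoinComplex_iff (hδ := hδ)).2
    ⟨S', ⟨hS'.trans hS, fun a ha b hb => hc a (hS' ha) b (hS' hb)⟩, by congr!⟩

theorem remaining_zero {n : ℕ} {ν : Fin (n + 1) → ℕ} {δ : Fin n → ℕ}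
    (hδ : ∀ i, δ i ≤ ν i.succ) : remaining ν δ 0 = boxes ν δ := by
  ext b
  simp [mem_remaining hδ, greedyBelow]

open Classical in
theorem isShelling_canonicalJoinComplex {n : ℕ} {ν : Fin (n + 1) → ℕ} {δ : Fin n → ℕ}
    (hδ : ∀ i, δ i ≤ ν i.succ) {L : List (Finset (ℕ × ℕ))}
    (hL : Shelling.IsShellingList (Shelling.independent (BoxIncompatible ν δ) (boxes ν δ)) L)
    {m : ℕ} (hm : m + 1 = L.length) :
    Shelling.IsShelling (canonicalJoinComplex ν δ)
      fun i : Fin (m + 1) => (L[i.val]'(hm ▸ i.2)).image (boxTree hδ) :=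
  hL.isShelling (fun _ hS => hS.1) boxTree_injOn (fun _ => mem_canonicalJoinComplex_iff) hm

theorem isShellable_canonicalJoinComplex {n : ℕ} {ν : Fin (n + 1) → ℕ} {δ : Fin n → ℕ}
    (hδ : ∀ i, δ i ≤ ν i.succ) : Shelling.IsShellable (canonicalJoinComplex ν δ) := by
  obtain ⟨L, hL⟩ := (decomposable_grid hδ (Finset.Ico 0 n)
    {x | ∀ a ∈ greedyBelow ν δ 0, a.1 ≠ x}).exists_isShellingList
      (adj := BoxIncompatible ν δ) (fun _ _ => BoxIncompatible.symm) not_boxIncompatible_self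
  rw [← remaining, remaining_zero hδ] at hL
  -- The empty face extends to a facet, so the list is nonempty, as the index type `Fin (m + 1)`
  -- requires.
  obtain ⟨G, -, hG⟩ := Shelling.exists_facet_of_independent
    (adj := BoxIncompatible ν δ) (W := boxes ν δ) (S := ∅) ⟨Finset.empty_subset _, by simp⟩
  have hpos := List.length_pos_of_mem ((hL.1 G).1 hG)
  exact ⟨L.length - 1, _, isShelling_canonicalJoinComplex hδ hL (by omega)⟩

theorem corollary1p3 {n : ℕ} (ν : Fin (n + 1) → ℕ) (δ : Fin n → ℕ) (hδ : ∀ i, δ i ≤ ν i.succ) :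
    Shelling.IsSimplicialComplex (canonicalJoinComplex ν δ) ∧
    Shelling.IsShellable (canonicalJoinComplex ν δ) ∧
    -- every linear order of the boxes in which boxes with larger labels come first
    ∀ pos : ℕ × ℕ → ℕ, Set.InjOn pos (boxes ν δ) →
      (∀ b ∈ boxes ν δ, ∀ b' ∈ boxes ν δ, label ν δ b' < label ν δ b → pos b < pos b') →
      ∃ (m : ℕ) (F : Fin (m + 1) → Finset (Tree ν δ)),
        Shelling.IsShelling (canonicalJoinComplex ν δ) F ∧
        -- the first facet is the one of the greedy boxes
        faceBoxes (F 0) = {b | b ∈ greedy ν δ} ∧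
        -- the facets are ordered by the last non-greedy box that they contain
        ∀ i j, i ≤ j → ∀ b ∈ faceBoxes (F i), b ∉ greedy ν δ →
          ∃ b' ∈ faceBoxes (F j), b' ∉ greedy ν δ ∧ pos b ≤ pos b' := by
  classical
  refine ⟨isSimplicialComplex_canonicalJoinComplex hδ, isShellable_canonicalJoinComplex hδ,
    fun pos _ hpos => ?_⟩
  obtain ⟨L, hL, hord⟩ := exists_shelling_remaining hδ hpos (Nat.zero_add n)
  rw [remaining_zero hδ] at hL
  rw [List.pairwise_iff_getElem] at hord
  have hsub : ∀ F ∈ _ :: L, F ⊆ boxes ν δ := fun F hF => ((hL.1 F).2 hF).prop.1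
  refine ⟨L.length, _, isShelling_canonicalJoinComplex hδ hL List.length_cons.symm, ?_, ?_⟩
  · rw [faceBoxes_image_boxTree (hsub _ (List.getElem_mem _))]
    ext b
    simp
  · intro i j hij b hb hbg
    rw [faceBoxes_image_boxTree (hsub _ (List.getElem_mem _))] at hb ⊢
    rcases hij.eq_or_lt with rfl | hlt
    · exact ⟨b, hb, hbg, le_rfl⟩
    · exact hord i.val j.val _ _ hlt b hb hbg
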